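/- Let $\mathcal S$ be an essentially small triangulated category with suspension $\Sigma$. For full subcategories $\mathcal A,\mathcal B\subset\mathcal S$ let $\mathcal A*\mathcal B$ be the full subcategory of all objects $b$ for which there is a distinguished triangle $a\to b\to c\to\Sigma a$ with $a\in\mathcal A$ and $c\in\mathcal B$. A metric on $\mathcal S$ is a sequence of additive subcategories $\mathcal M_1\supset\mathcal M_2\supset\mathcal M_3\supset\cdots$ of $\mathcal S$ with $\mathcal M_i*\mathcal M_i=\mathcal M_i$ for every $i$. A sequence $E_1\to E_2\to E_3\to\cdots$ in $\mathcal S$ is Cauchy if for all $i>0$ and $j\in\mathbb Z$ there is an integer $M>0$ such that, in every distinguished triangle $E_m\to E_{m'}\to D\to\Sigma E_m$ with $M\le m<m'$, the object $\Sigma^jD$ lies in $\mathcal M_i$. A Cauchy sequence of triangles is a sequence of distinguished triangles $a_*\to b_*\to c_*\to\Sigma a_*$ in $\mathcal S$ and morphisms of triangles between them, such that $a_*$, $b_*$ and $c_*$ are Cauchy. Let $\mathrm{Mod}\,\mathcal S$ be the category of additive functors $\mathcal S^{\mathrm{op}}\to\mathrm{Mod}\,\mathbb Z$, with the automorphism $\Sigma$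 given by $(\Sigma A)(s)=A(\Sigma^{-1}s)$, and let $Y:\mathcal S\to\mathrm{Mod}\,\mathcal S$, $Y(s)=\mathrm{Hom}(-,s)$, be the Yoneda functor, so that $Y\Sigma\cong\Sigma Y$ canonically. Let $\mathfrak L(\mathcal S)\subset\mathrm{Mod}\,\mathcal S$ be the full subcategory of the functors isomorphic to $\mathrm{colim}\,Y(E_*)$ for some Cauchy sequence $E_*$; let $\mathfrak C(\mathcal S)\subset\mathrm{Mod}\,\mathcal S$ be the full subcategory of the functors $A$ such that for every $j\in\mathbb Z$ there is $i>0$ with $\mathrm{Hom}(Y(\Sigma^jX),A)=0$ for all $X\in\mathcal M_i$; and let $\mathfrak S(\mathcal S)=\mathfrak L(\mathcal S)\cap\mathfrak C(\mathcal S)$. Then, for any metric $\{\mathcal M_i\}$ on $\mathcal S$, the category $\mathfrak S(\mathcal S)$, with the suspension $\Sigma$ inherited from $\mathrm{Mod}\,\mathcal S$, is a triangulated category, in which a sequence $A\to B\to C\to\Sigma A$ in $\mathfrak S(\mathcal S)$ is a distinguished triangle if and only if it is isomorphic to the colimit in $\mathrm{Mod}\,\mathcal S$ of the image under $Y$ of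 some Cauchy sequence of triangles in $\mathcal S$. -/

import Mathlib

open CategoryTheory CategoryTheory.Limits CategoryTheory.Pretriangulated Opposite ZeroObject

universe v u

namespace MetricCompletion

section Shift

variable {C : Type u} [Category.{v} C] [HasShift C ℤ]

lemma shiftFunctorAdd'_congr (a b c c' : ℤ) (h : a + b = c) (h' : a + b = c') (X : C)
    (e : (shiftFunctor C c).obj X = (shiftFunctor C c').obj X) :
    (shiftFunctorAdd' C a b c h).inv.app X ≫ eqToHom e =
    (shiftFunctorAdd' C a b c' h').inv.app X := by
  subst h; subst h'; simp

lemma shiftFunctorAdd'_right_zero (a z c : ℤ) (hz : z = 0) (h : a + z = c) (X : C)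
    (e : (shiftFunctor C a).obj X = (shiftFunctor C c).obj X) :
    (shiftFunctorAdd' C a z c h).inv.app X =
      (shiftFunctorZero' C z hz).hom.app (X⟦a⟧) ≫ eqToHom e := by
  subst hz
  obtain rfl : a = c := by lia
  simp [shiftFunctorZero', shiftFunctorAdd'_add_zero_inv_app]

lemma shiftFunctorAdd'_left_zero (z a c : ℤ) (hz : z = 0) (h : z + a = c) (X : C)
    (e : (shiftFunctor C a).obj X = (shiftFunctor C c).obj X) :
    (shiftFunctorAdd' C z a c h).inv.app X =
      ((shiftFunctorZero' C z hz).hom.app X)⟦a⟧' ≫ eqToHom e := by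
  subst hz
  obtain rfl : a = c := by lia
  simp [shiftFunctorZero', shiftFunctorAdd'_zero_add_inv_app]

end Shift

section Modules

variable (C : Type u) [Category.{v} C] [Preadditive C]

/-- The category `Mod C` of additive functors from `Cᵒᵖ` to abelian groups (that is, to
`ℤ`-modules). -/
abbrev Modules := Cᵒᵖ ⥤+ AddCommGrpCat.{v}

/-- The Yoneda functor `Y : C ⥤ Mod C`, which sends `X` to `Hom(-, X)`. -/
abbrev yonedaModules : C ⥤ Modules C :=
  (additiveFunctor Cᵒᵖ AddCommGrpCat.{v}).lift preadditiveYoneda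
    (fun X => additive_yonedaObj' X)

variable [HasShift C ℤ] [∀ n : ℤ, (shiftFunctor C n).Additive]

/-- The shift by `n` on `Mod C`: the functor `A` is sent to `s ↦ A (s⟦-n⟧)`. -/
def modShift (n : ℤ) : Modules C ⥤ Modules C where
  obj A := ⟨(shiftFunctor C (-n)).op ⋙ A.obj, (inferInstance : Functor.Additive _)⟩
  map φ := ObjectProperty.homMk (Functor.whiskerLeft _ φ.hom)

/-- The shift by `0` on `Mod C` is isomorphic to the identity. -/
noncomputable def modShiftZero : modShift C 0 ≅ 𝟭 (Modules C) :=
  NatIso.ofComponents (fun A => ObjectProperty.isoMk _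
    (Functor.isoWhiskerRight (NatIso.op (shiftFunctorZero' C (-0 : ℤ) neg_zero)).symm A.obj))
    (fun {A B} φ => by
      apply ObjectProperty.hom_ext
      apply NatTrans.ext
      funext s
      exact (φ.hom.naturality _).symm)

/-- The shift by `n + m` on `Mod C` is the shift by `n` followed by the shift by `m`. -/
noncomputable def modShiftAdd (n m : ℤ) : modShift C (n + m) ≅ modShift C n ⋙ modShift C m :=
  NatIso.ofComponents (fun A => ObjectProperty.isoMk _
    (Functor.isoWhiskerRight
      (NatIso.op (shiftFunctorAdd' C (-m) (-n) (-(n + m)) (by lia))).symm A.obj))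
    (fun {A B} φ => by
      apply ObjectProperty.hom_ext
      apply NatTrans.ext
      funext s
      exact (φ.hom.naturality _).symm)

variable {C}

lemma eqToHom_modShift_app {n m : ℤ} (h : n = m) (A : Modules C) (s : Cᵒᵖ)
    (e : (modShift C n).obj A = (modShift C m).obj A) :
    (eqToHom e).hom.app s = A.obj.map (eqToHom (by subst h; rfl :
      op ((shiftFunctor C (-n)).obj s.unop) = op ((shiftFunctor C (-m)).obj s.unop))) := by
  subst h
  exact (A.obj.map_id _).symm

/-- The shift functors on `Mod C`, with their coherence. -/
noncomputable def modShiftCore : ShiftMkCore (Modules C) ℤ where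
  F := modShift C
  zero := modShiftZero C
  add := modShiftAdd C
  assoc_hom_app m₁ m₂ m₃ A := by
    apply ObjectProperty.hom_ext
    apply NatTrans.ext
    funext s
    change _ = (eqToHom _ : (modShift C _).obj A ⟶ (modShift C _).obj A).hom.app s ≫ _
    rw [eqToHom_modShift_app (add_assoc m₁ m₂ m₃)]
    change A.obj.map _ ≫ A.obj.map _ = A.obj.map _ ≫ A.obj.map _ ≫ A.obj.map _
    simp only [← A.obj.map_comp]
    congr 1
    apply Quiver.Hom.unop_inj
    rw [unop_comp, unop_comp, unop_comp, eqToHom_unop, Category.assoc]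
    change (shiftFunctorAdd' C (-m₂) (-m₁) (-(m₁ + m₂)) (by lia)).inv.app (s.unop⟦-m₃⟧) ≫
        (shiftFunctorAdd' C (-m₃) (-(m₁ + m₂)) (-(m₁ + m₂ + m₃)) (by lia)).inv.app s.unop =
      ((shiftFunctorAdd' C (-m₃) (-m₂) (-(m₂ + m₃)) (by lia)).inv.app s.unop)⟦-m₁⟧' ≫
        (shiftFunctorAdd' C (-(m₂ + m₃)) (-m₁) (-(m₁ + (m₂ + m₃))) (by lia)).inv.app s.unop ≫ _
    rw [shiftFunctorAdd'_congr _ _ _ (-(m₁ + m₂ + m₃)) _ (by lia),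
      shiftFunctorAdd'_assoc_inv_app (-m₃) (-m₂) (-m₁) _ (-(m₁ + m₂)) _ _ (by lia) (by lia)]
  zero_add_hom_app n A := by
    apply ObjectProperty.hom_ext
    apply NatTrans.ext
    funext s
    change _ = (eqToHom _ : (modShift C _).obj A ⟶ (modShift C _).obj A).hom.app s ≫ _
    rw [eqToHom_modShift_app (zero_add n)]
    change A.obj.map _ = A.obj.map _ ≫ A.obj.map _
    simp only [← A.obj.map_comp]
    congr 1
    apply Quiver.Hom.unop_inj
    rw [unop_comp, eqToHom_unop]
    change (shiftFunctorAdd' C (-n) (-0) (-(0 + n)) (by lia)).inv.app s.unop =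
      (shiftFunctorZero' C (-0 : ℤ) neg_zero).hom.app (s.unop⟦-n⟧) ≫ _
    exact shiftFunctorAdd'_right_zero _ _ _ _ _ _ _
  add_zero_hom_app n A := by
    apply ObjectProperty.hom_ext
    apply NatTrans.ext
    funext s
    change _ = (eqToHom _ : (modShift C _).obj A ⟶ (modShift C _).obj A).hom.app s ≫ _
    rw [eqToHom_modShift_app (add_zero n)]
    change A.obj.map _ = A.obj.map _ ≫ A.obj.map _
    simp only [← A.obj.map_comp]
    congr 1
    apply Quiver.Hom.unop_inj
    rw [unop_comp, eqToHom_unop]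
    change (shiftFunctorAdd' C (-0) (-n) (-(n + 0)) (by lia)).inv.app s.unop =
      ((shiftFunctorZero' C (-0 : ℤ) neg_zero).hom.app s.unop)⟦-n⟧' ≫ _
    exact shiftFunctorAdd'_left_zero _ _ _ _ _ _ _

noncomputable instance : HasShift (Modules C) ℤ := hasShiftMk _ _ modShiftCore

instance (n : ℤ) : (shiftFunctor (Modules C) n).Additive where
  map_add := rfl


/-- The adjunction isomorphism `Hom(s, X⟦n⟧) ≃ Hom(s⟦-n⟧, X)`. -/
def shiftHomEquiv (n : ℤ) (s X : C) : (s ⟶ X⟦n⟧) ≃+ (s⟦-n⟧ ⟶ X) where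
  toFun f := f⟦-n⟧' ≫ (shiftFunctorCompIsoId C n (-n) (add_neg_cancel n)).hom.app X
  invFun g := (shiftFunctorCompIsoId C (-n) n (neg_add_cancel n)).inv.app s ≫ g⟦n⟧'
  left_inv f := by
    dsimp only
    rw [Functor.map_comp, shift_shiftFunctorCompIsoId_add_neg_cancel_hom_app]
    exact shiftFunctorCompIsoId_naturality_1 (f := f) ..
  right_inv g := by
    dsimp only
    rw [Functor.map_comp, shift_shiftFunctorCompIsoId_neg_add_cancel_inv_app, Category.assoc]
    exact shiftFunctorCompIsoId_naturality_1 (f := g) ..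
  map_add' f g := by rw [Functor.map_add, Preadditive.add_comp]

/-- The isomorphism `Y (X⟦n⟧) ≅ (Y X)⟦n⟧`, given at `s` by `Hom(s, X⟦n⟧) ≃ Hom(s⟦-n⟧, X)`. -/
noncomputable def yonedaModulesShiftIso (n : ℤ) :
    shiftFunctor C n ⋙ yonedaModules C ≅ yonedaModules C ⋙ shiftFunctor (Modules C) n :=
  NatIso.ofComponents (fun X => ObjectProperty.isoMk _ (NatIso.ofComponents
    (fun s => (shiftHomEquiv n s.unop X).toAddCommGrpIso)
    (fun {s t} f => by
      ext (g : s.unop ⟶ X⟦n⟧)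
      change (f.unop ≫ g)⟦-n⟧' ≫ _ = f.unop⟦-n⟧' ≫ g⟦-n⟧' ≫ _
      rw [Functor.map_comp, Category.assoc])))
    (fun {X Y} f => by
      apply ObjectProperty.hom_ext
      apply NatTrans.ext
      funext s
      ext (g : s.unop ⟶ X⟦n⟧)
      change (g ≫ f⟦n⟧')⟦-n⟧' ≫ (shiftFunctorCompIsoId C n (-n) (add_neg_cancel n)).hom.app Y =
        (g⟦-n⟧' ≫ (shiftFunctorCompIsoId C n (-n) (add_neg_cancel n)).hom.app X) ≫ f
      rw [Functor.map_comp, Category.assoc, Category.assoc]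
      congr 1
      exact (shiftFunctorCompIsoId C n (-n) (add_neg_cancel n)).hom.naturality f)

noncomputable instance : (yonedaModules C).CommShift ℤ where
  commShiftIso := yonedaModulesShiftIso
  commShiftIso_zero := by
    apply Iso.ext
    apply NatTrans.ext
    funext X
    apply ObjectProperty.hom_ext
    apply NatTrans.ext
    funext s
    ext (g : s.unop ⟶ X⟦(0 : ℤ)⟧)
    rw [Functor.CommShift.isoZero_hom_app]
    change g⟦-0⟧' ≫ (shiftFunctorCompIsoId C 0 (-0) (add_neg_cancel 0)).hom.app X =
      (shiftFunctorZero' C (-0 : ℤ) neg_zero).hom.app s.unop ≫ g ≫ (shiftFunctorZero C ℤ).hom.app X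
    have h : g⟦(-0 : ℤ)⟧' ≫ (shiftFunctorZero' C (-0 : ℤ) neg_zero).hom.app _ =
        (shiftFunctorZero' C (-0 : ℤ) neg_zero).hom.app s.unop ≫ g :=
      (shiftFunctorZero' C (-0 : ℤ) neg_zero).hom.naturality g
    rw [← reassoc_of% h, shiftFunctorCompIsoId, Iso.trans_hom, Iso.symm_hom,
      NatTrans.comp_app, shiftFunctorAdd'_right_zero _ _ _ neg_zero _ _ rfl]
    simp
  commShiftIso_add a b := by
    apply Iso.ext
    apply NatTrans.ext
    funext X
    apply ObjectProperty.hom_ext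
    apply NatTrans.ext
    funext s
    ext (g : s.unop ⟶ X⟦a + b⟧)
    rw [Functor.CommShift.isoAdd_hom_app]
    change g⟦-(a+b)⟧' ≫ (shiftFunctorCompIsoId C (a+b) (-(a+b)) (add_neg_cancel _)).hom.app X =
      (shiftFunctorAdd' C (-b) (-a) (-(a + b)) (by lia)).hom.app s.unop ≫
       (((g ≫ (shiftFunctorAdd C a b).hom.app X)⟦-b⟧' ≫
          (shiftFunctorCompIsoId C b (-b) (add_neg_cancel b)).hom.app (X⟦a⟧))⟦-a⟧' ≫
         (shiftFunctorCompIsoId C a (-a) (add_neg_cancel a)).hom.app X)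
    rw [shiftFunctorCompIsoId_add'_hom_app (-b) (-a) (-(a+b)) b a (a+b) (by lia) (by lia)
        (by lia) (by lia),
      shiftFunctorAdd'_eq_shiftFunctorAdd]
    simp only [Functor.map_comp, Category.assoc]
    have h {X Y : C} (g : X ⟶ Y) :
        g⟦-(a + b)⟧' ≫ (shiftFunctorAdd' C (-b) (-a) (-(a + b)) (by lia)).hom.app Y =
        (shiftFunctorAdd' C (-b) (-a) (-(a + b)) (by lia)).hom.app X ≫ g⟦-b⟧'⟦-a⟧' :=
      (shiftFunctorAdd' C (-b) (-a) (-(a + b)) (by lia)).hom.naturality g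
    erw [reassoc_of% h, reassoc_of% h]

end Modules

section Metric

variable (C : Type u) [Category.{v} C] [Preadditive C] [HasZeroObject C] [HasShift C ℤ]
  [∀ n : ℤ, (shiftFunctor C n).Additive] [Pretriangulated C]

/-- A metric on a triangulated category `C`: a decreasing sequence `M i` of full additive
subcategories with `M i * M i = M i`, where `A * B` is the full subcategory of the objects `b`
which sit in a distinguished triangle `a ⟶ b ⟶ c ⟶ a⟦1⟧` with `a` in `A` and `c` in `B`. -/
structure Metric where
  /-- the full subcategories of which the metric consists -/
  M : ℕ → ObjectProperty C
  containsZero (i : ℕ) : (M i).ContainsZero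
  biprod (i : ℕ) (X Y : C) : M i X → M i Y → M i (X ⊞ Y)
  antitone (i : ℕ) : M (i + 1) ≤ M i
  extension (i : ℕ) : (M i).extensionProduct (M i) = M i

namespace Metric

variable {C} (μ : Metric C)

lemma isClosedUnderIsomorphisms (i : ℕ) : (μ.M i).IsClosedUnderIsomorphisms := by
  rw [← μ.extension i]; infer_instance

/-- A sequence `E 0 ⟶ E 1 ⟶ E 2 ⟶ ⋯` is Cauchy if for all `i` and all integers `j` there is `N`
such that in every distinguished triangle `E m ⟶ E m' ⟶ D ⟶ (E m)⟦1⟧` with `N ≤ m < m'` the object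
`D⟦j⟧` lies in `M i`. (Since the `M i` decrease, it does not matter where the index `i` starts.) -/
def IsCauchy (E : ℕ ⥤ C) : Prop :=
  ∀ (i : ℕ) (j : ℤ), ∃ N : ℕ, ∀ (m m' : ℕ) (h : m < m'), N ≤ m →
    ∀ (D : C) (p : E.obj m' ⟶ D) (q : D ⟶ (E.obj m)⟦(1 : ℤ)⟧),
      Triangle.mk (E.map (homOfLE h.le)) p q ∈ distTriang C → μ.M i (D⟦j⟧)

/-- The full subcategory `𝔏(C)` of `Mod C`: the colimits of the Yoneda images of Cauchy
sequences. -/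
def cauchyColimits : ObjectProperty (Modules C) := fun A =>
  ∃ (E : ℕ ⥤ C) (_ : μ.IsCauchy E) (α : E ⋙ yonedaModules C ⟶ (Functor.const ℕ).obj A),
    Nonempty (IsColimit (Cocone.mk A α))

/-- The full subcategory `ℭ(C)` of `Mod C`: the compactly supported functors `A`, such that for
every integer `j` there is `i` with `Hom(Y(X⟦j⟧), A) = 0` for all `X` in `M i`. -/
def compactlySupported : ObjectProperty (Modules C) := fun A =>
  ∀ j : ℤ, ∃ i : ℕ, ∀ X : C, μ.M i X → ∀ φ : (yonedaModules C).obj (X⟦j⟧) ⟶ A, φ = 0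

/-- The full subcategory `𝔖(C) = 𝔏(C) ∩ ℭ(C)` of `Mod C`. -/
def completion : ObjectProperty (Modules C) := μ.cauchyColimits ⊓ μ.compactlySupported

variable {μ} in
/-- The shift of a Cauchy sequence is Cauchy. -/
lemma IsCauchy.shift {E : ℕ ⥤ C} (hE : μ.IsCauchy E) (n : ℤ) :
    μ.IsCauchy (E ⋙ shiftFunctor C n) := by
  intro i j
  obtain ⟨N, hN⟩ := hE i (n + j)
  refine ⟨N, fun m m' h hm D p q hD => ?_⟩
  obtain ⟨D', p', q', hD'⟩ := distinguished_cocone_triangle (E.map (homOfLE h.le))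
  have h₁ := hN m m' h hm D' p' q' hD'
  have h₂ := Triangle.shift_distinguished _ hD' n
  have := μ.isClosedUnderIsomorphisms i
  let e : (E.obj m)⟦n⟧ ≅ (E.obj m)⟦n⟧ :=
    { hom := n.negOnePow • 𝟙 _
      inv := n.negOnePow • 𝟙 _
      hom_inv_id := by simp [smul_smul]
      inv_hom_id := by simp [smul_smul] }
  let f := isoTriangleOfIso₁₂ _ _ h₂ hD e (Iso.refl _) (by
    change (n.negOnePow • (E.map (homOfLE h.le))⟦n⟧') ≫ 𝟙 _ =
      (n.negOnePow • 𝟙 _) ≫ (E.map (homOfLE h.le))⟦n⟧'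
    rw [Category.comp_id, Linear.units_smul_comp, Category.id_comp])
  exact (μ.M i).prop_of_iso ((shiftFunctorAdd C n j).app D' ≪≫
    (shiftFunctor C j).mapIso (Triangle.π₃.mapIso f)) h₁

instance : μ.cauchyColimits.IsStableUnderShift ℤ where
  isStableUnderShiftBy n :=
    { le_shift := by
        rintro A ⟨E, hE, α, ⟨hα⟩⟩
        let e : (E ⋙ shiftFunctor C n) ⋙ yonedaModules C ≅
            (E ⋙ yonedaModules C) ⋙ shiftFunctor (Modules C) n :=
          Functor.isoWhiskerLeft E ((yonedaModules C).commShiftIso n)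
        let c := (shiftFunctor (Modules C) n).mapCocone (Cocone.mk A α)
        exact ⟨_, hE.shift n, e.hom ≫ c.ι,
          ⟨(IsColimit.precomposeHomEquiv e c).symm
            (isColimitOfPreserves (shiftFunctor (Modules C) n) hα)⟩⟩ }

instance : μ.compactlySupported.IsStableUnderShift ℤ where
  isStableUnderShiftBy n :=
    { le_shift := fun A hA j => by
        obtain ⟨i, hi⟩ := hA (j + -n)
        refine ⟨i, fun X hX φ => ?_⟩
        apply (shiftFunctor (Modules C) (-n)).map_injective
        rw [Functor.map_zero]
        have := hi X hX ((yonedaModules C).map ((shiftFunctorAdd C j (-n)).hom.app X) ≫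
          ((yonedaModules C).commShiftIso (-n)).hom.app (X⟦j⟧) ≫ φ⟦-n⟧' ≫
          (shiftFunctorCompIsoId (Modules C) n (-n) (add_neg_cancel n)).hom.app A)
        rwa [Preadditive.IsIso.comp_left_eq_zero, Preadditive.IsIso.comp_left_eq_zero,
          Preadditive.IsIso.comp_right_eq_zero] at this }

instance : μ.completion.IsStableUnderShift ℤ :=
  inferInstanceAs ((μ.cauchyColimits ⊓ μ.compactlySupported).IsStableUnderShift ℤ)

instance : μ.completion.ContainsZero where
  exists_zero := by
    have hz : IsZero ((yonedaModules C).obj 0) := by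
      rw [IsZero.iff_id_eq_zero]
      apply ObjectProperty.hom_ext
      apply NatTrans.ext
      funext s
      ext (g : s.unop ⟶ 0)
      exact (isZero_zero C).eq_of_tgt _ _
    refine ⟨_, hz, ⟨(Functor.const ℕ).obj 0, fun i j => ⟨0, fun m m' h _ D p q hD => ?_⟩,
      { app := fun _ => 𝟙 _, naturality := fun _ _ _ => hz.eq_of_src _ _ }, ⟨?_⟩⟩,
      fun j => ⟨0, fun X hX φ => hz.eq_of_tgt _ _⟩⟩
    · have := μ.isClosedUnderIsomorphisms i
      have := μ.containsZero i
      have hD : IsZero D := Triangle.isZero₃_of_isIso₁ _ hD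
        (inferInstanceAs (IsIso (𝟙 (0 : C))))
      exact (μ.M i).prop_of_isZero ((shiftFunctor C j).map_isZero hD)
    · exact
        { desc := fun _ => 0
          fac := fun _ _ => hz.eq_of_src _ _
          uniq := fun _ _ _ => hz.eq_of_src _ _ }

/-- A triangle `T` in `Mod C` is a colimit of a Cauchy sequence of triangles if there are a sequence
`t 0 ⟶ t 1 ⟶ ⋯` of distinguished triangles in `C`, the three sequences of its vertices being Cauchy,
and a compatible family of morphisms of triangles from the Yoneda images `Y(t m)` to `T` which
makes each of the three vertices of `T` the colimit in `Mod C` of the corresponding vertices of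
the `Y(t m)`. This property is invariant under isomorphisms of triangles. -/
def IsColimitOfCauchyTriangles (T : Triangle (Modules C)) : Prop :=
  ∃ (t : ℕ ⥤ Triangle C) (_ : ∀ m, t.obj m ∈ distTriang C)
    (_ : μ.IsCauchy (t ⋙ Triangle.π₁)) (_ : μ.IsCauchy (t ⋙ Triangle.π₂))
    (_ : μ.IsCauchy (t ⋙ Triangle.π₃))
    (α : t ⋙ (yonedaModules C).mapTriangle ⟶ (Functor.const ℕ).obj T),
    Nonempty (IsColimit (Triangle.π₁.mapCocone (Cocone.mk T α))) ∧
    Nonempty (IsColimit (Triangle.π₂.mapCocone (Cocone.mk T α))) ∧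
    Nonempty (IsColimit (Triangle.π₃.mapCocone (Cocone.mk T α)))

/-- The triangles in `𝔖(C)` that are to be the distinguished ones: those which are colimits in
`Mod C` of the Yoneda images of Cauchy sequences of distinguished triangles in `C`. -/
def distinguishedTriangles : Set (Triangle μ.completion.FullSubcategory) :=
  {T | μ.IsColimitOfCauchyTriangles (μ.completion.ι.mapTriangle.obj T)}

end Metric
end Metric
end MetricCompletion

/-!
# The completion of a triangulated category with respect to a metric

An object of `𝔖(C)` is the colimit `A` in `Mod C` of the Yoneda image of a Cauchy sequence `E`.
Two facts make its category accessible from `C`.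

* Representable functors are finitely presented in `Mod C`, so morphisms between such colimits lift
  to the presenting sequences after reindexing the target (`Presentation.exists_lift`).
* If `B` in `𝔏(C)` is compactly supported, it is a cohomological functor on which the objects of
  some `M i` and `(M i)⟦-1⟧` vanish. The cones of `E m ⟶ E m'` lie in `M i` for `m` large, so
  `Hom(A, B) = Hom(Y(E m), B)` for every late stage `m` (`Presentation.exists_isLocal_π`). The stage
  depends on `B` only through `i`, and this uniformity is what `localObjects` records.

The cone of a morphism of `𝔖(C)` is obtained by lifting it to sequences and choosing cones with
transition morphisms given by two octahedra (`exists_good_morphism`); the cone of such a transition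
morphism is an extension of cones of transition morphisms of the given sequences, so the
new sequence is again Cauchy (`exists_trianglePresentation`). Its colimit is compactly supported
because colimits of distinguished triangles are exact.

The remaining axioms are transported from a single stage. A morphism between two triangles is
completed at one late stage, by the axiom in `C`, and extended to the colimit with the second fact.
For the octahedral axiom, one takes an octahedron of `C` at a late stage and extends
its two new morphisms `Z₁₂ ⟶ Z₁₃ ⟶ Z₂₃` to the colimits. To see that these form a distinguished
triangle, present a cone `Q` of `Z₁₂ ⟶ Z₁₃` as above. A good morphism maps the triangle of `C` at
the late stage to a still later stage of this presentation, with cones in `M i`; hence the late stage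
of `Z₂₃` has the same morphisms to local objects as `Q` and as `Z₂₃`, and `Q ≅ Z₂₃`
(`isColimitOfCauchyTriangles_of_isLocal`).
-/

/-! ### Sequential colimits of representable functors -/

namespace MetricCompletion

section Colimits

variable {C : Type u} [Category.{v} C] [Preadditive C]

/-- Additive functors are closed under sequential colimits. -/
instance : (additiveFunctor Cᵒᵖ AddCommGrpCat.{v}).IsClosedUnderColimitsOfShape ℕ where
  colimitsOfShape_le := by
    rintro G ⟨p⟩
    refine ⟨fun {X Y f g} => ?_⟩
    refine (isColimitOfPreserves ((evaluation _ _).obj X) p.isColimit).hom_ext fun n => ?_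
    have : (p.diag.obj n).Additive := p.prop_diag_obj n
    change (p.ι.app n).app X ≫ G.map (f + g) = (p.ι.app n).app X ≫ (G.map f + G.map g)
    have nat (h : X ⟶ Y) : (p.ι.app n).app X ≫ G.map h = (p.diag.obj n).map h ≫
        (p.ι.app n).app Y := ((p.ι.app n).naturality h).symm
    rw [Preadditive.comp_add, nat, nat, nat, Functor.map_add, Preadditive.add_comp]

lemma yoneda_hom_ext {s : C} {A : Modules C} {x y : (yonedaModules C).obj s ⟶ A}
    (h : x.hom.app (op s) (𝟙 s) = y.hom.app (op s) (𝟙 s)) : x = y := by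
  apply ObjectProperty.hom_ext
  apply NatTrans.ext
  funext t
  ext (f : t.unop ⟶ s)
  have key (z : (yonedaModules C).obj s ⟶ A) :
      z.hom.app t f = A.obj.map f.op (z.hom.app (op s) (𝟙 s)) := by
    have := ConcreteCategory.congr_hom (z.hom.naturality f.op) (𝟙 s)
    change z.hom.app t (f ≫ 𝟙 s) = _ at this
    rwa [Category.comp_id] at this
  exact (key x).trans ((congrArg (A.obj.map f.op) h).trans (key y).symm)

instance : (yonedaModules C).Faithful where
  map_injective {X _ f g} h := by
    have : 𝟙 X ≫ f = 𝟙 X ≫ g := congrArg (fun z => z.hom.app (op X) (𝟙 X)) h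
    rwa [Category.id_comp, Category.id_comp] at this

instance : (yonedaModules C).Full where
  map_surjective {X _} x := ⟨x.hom.app (op X) (𝟙 X), yoneda_hom_ext (Category.id_comp _)⟩

instance : (yonedaModules C).Additive where
  map_add := yoneda_hom_ext (Preadditive.comp_add _ _ _ _ _ _)

variable {E : ℕ ⥤ C} {A : Modules C} {α : E ⋙ yonedaModules C ⟶ (Functor.const ℕ).obj A}

instance : PreservesColimitsOfShape ℕ (forget AddCommGrpCat.{v}) :=
  have := preservesFilteredColimitsOfSize_shrink.{0, v, 0, v} (forget AddCommGrpCat.{v})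
  inferInstance

/-- The transition relation of a cocone, in a form convenient for rewriting. -/
lemma cocone_w (α : E ⋙ yonedaModules C ⟶ (Functor.const ℕ).obj A) {m n : ℕ} (h : m ⟶ n) :
    (yonedaModules C).map (E.map h) ≫ α.app n = α.app m :=
  (α.naturality h).trans (Category.comp_id _)

/-- Representable functors are finitely presented: a morphism from a representable functor to a
sequential colimit factors through a stage. -/
lemma exists_factor (hα : IsColimit (Cocone.mk A α)) {s : C}
    (x : (yonedaModules C).obj s ⟶ A) :
    ∃ (n : ℕ) (f : s ⟶ E.obj n), (yonedaModules C).map f ≫ α.app n = x := by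
  let G := AdditiveFunctor.forget Cᵒᵖ AddCommGrpCat.{v} ⋙ (evaluation _ _).obj (op s)
  obtain ⟨n, f, hf⟩ := Concrete.isColimit_exists_rep _ (isColimitOfPreserves G hα)
    (x.hom.app (op s) (𝟙 s))
  refine ⟨n, f, yoneda_hom_ext (.trans ?_ hf)⟩
  change (α.app n).hom.app (op s) (𝟙 s ≫ (show s ⟶ E.obj n from f)) = _
  rw [Category.id_comp]
  rfl

/-- Two morphisms to a stage of a sequential colimit which agree in the colimit agree at a later
stage. -/
lemma exists_map_eq (hα : IsColimit (Cocone.mk A α)) {s : C} {n : ℕ} {f g : s ⟶ E.obj n}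
    (h : (yonedaModules C).map f ≫ α.app n = (yonedaModules C).map g ≫ α.app n) :
    ∃ (m : ℕ) (hm : n ≤ m), f ≫ E.map (homOfLE hm) = g ≫ E.map (homOfLE hm) := by
  let G := AdditiveFunctor.forget Cᵒᵖ AddCommGrpCat.{v} ⋙ (evaluation _ _).obj (op s)
  have key (f : s ⟶ E.obj n) : ((yonedaModules C).map f ≫ α.app n).hom.app (op s) (𝟙 s) =
      (α.app n).hom.app (op s) f := by
    change (α.app n).hom.app (op s) (𝟙 s ≫ f) = _
    rw [Category.id_comp]
  have h' : (α.app n).hom.app (op s) f = (α.app n).hom.app (op s) g := by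
    rw [← key, h, key]
  obtain ⟨m, a, b, hab⟩ := Concrete.isColimit_exists_of_rep_eq _ (isColimitOfPreserves G hα)
    (i := n) (j := n) f g h'
  obtain rfl : a = b := Subsingleton.elim _ _
  exact ⟨m, leOfHom a, hab⟩

end Colimits

end MetricCompletion

/-! ### Cones of morphisms and Cauchy sequences in a triangulated category -/

namespace MetricCompletion

section Cones

variable {C : Type u} [Category.{v} C] [Preadditive C] [HasZeroObject C] [HasShift C ℤ]
  [∀ n : ℤ, (shiftFunctor C n).Additive] [Pretriangulated C]

instance (P : ObjectProperty C) [P.IsClosedUnderIsomorphisms] [P.IsTriangulatedClosed₂] (n : ℤ) :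
    (P.shift n).IsTriangulatedClosed₂ :=
  .mk' fun T hT h₁ h₃ =>
    P.ext_of_isTriangulatedClosed₂ _ (Triangle.shift_distinguished T hT n) h₁ h₃

variable [IsTriangulated C]

/-- Morphisms with cone in an extension-closed class `P` compose, as the cone of a composite is
an extension of the cones. -/
lemma trW_comp (P : ObjectProperty C) [P.IsClosedUnderIsomorphisms] [P.IsTriangulatedClosed₂]
    {X Y Z : C} {f : X ⟶ Y} {g : Y ⟶ Z} (hf : P.trW f) (hg : P.trW g) : P.trW (f ≫ g) := by
  obtain ⟨_, _, _, Hf, hf⟩ := hf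
  obtain ⟨_, _, _, Hg, hg⟩ := hg
  obtain ⟨_, _, _, H⟩ := distinguished_cocone_triangle (f ≫ g)
  exact ⟨_, _, _, H, P.ext_of_isTriangulatedClosed₂ _
    (Triangulated.someOctahedron rfl Hf Hg H).mem hf hg⟩

/-- A commutative square extends to a morphism of distinguished triangles such that the cone of
its third component is an extension of the suspended cone of the first component by the cone of
the second one. -/
lemma exists_good_morphism {T T' : Triangle C} (hT : T ∈ distTriang C) (hT' : T' ∈ distTriang C)
    (a : T.obj₁ ⟶ T'.obj₁) (b : T.obj₂ ⟶ T'.obj₂) (h : T.mor₁ ≫ b = a ≫ T'.mor₁) :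
    ∃ φ : T ⟶ T', φ.hom₁ = a ∧ φ.hom₂ = b ∧ ∀ (P : ObjectProperty C)
      [P.IsClosedUnderIsomorphisms] [P.IsTriangulatedClosed₂],
      (P.shift (1 : ℤ)).trW a → P.trW b → P.trW φ.hom₃ := by
  obtain ⟨A, a', a'', ha⟩ := distinguished_cocone_triangle a
  obtain ⟨B, b', b'', hb⟩ := distinguished_cocone_triangle b
  obtain ⟨D, d', d'', hd⟩ := distinguished_cocone_triangle (T.mor₁ ≫ b)
  -- The third component is the composite of two morphisms through the cone of the diagonal.
  let O₁ := Triangulated.someOctahedron rfl hT hb hd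
  let O₂ := Triangulated.someOctahedron h.symm ha hT' hd
  refine ⟨O₁.triangleMorphism₁ ≫ O₂.triangleMorphism₂, Category.id_comp _, Category.comp_id _,
    fun P _ _ hA hB => ?_⟩
  refine trW_comp P ⟨_, _, _, O₁.mem, ?_⟩ ⟨_, _, _, rot_of_distTriang _ O₂.mem, ?_⟩
  · exact (P.trW_iff_of_distinguished _ hb).1 hB
  · exact ((P.shift (1 : ℤ)).trW_iff_of_distinguished _ ha).1 hA

/-- A morphism between sequences extends to a sequence of triangles on any prescribed cones, with
transition morphisms on the cones as in `exists_good_morphism`. -/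
lemma exists_transition {E F : ℕ ⥤ C} (a : E ⟶ F) {Z : ℕ → C} (b : ∀ n, F.obj n ⟶ Z n)
    (c : ∀ n, Z n ⟶ (E.obj n)⟦(1 : ℤ)⟧)
    (h : ∀ n, Triangle.mk (a.app n) (b n) (c n) ∈ distTriang C) :
    ∃ z : ∀ n, Z n ⟶ Z (n + 1),
      (∀ n, F.map (homOfLE n.le_succ) ≫ b (n + 1) = b n ≫ z n) ∧
      (∀ n, z n ≫ c (n + 1) = c n ≫ (E.map (homOfLE n.le_succ))⟦(1 : ℤ)⟧') ∧
      ∀ (P : ObjectProperty C) [P.IsClosedUnderIsomorphisms] [P.IsTriangulatedClosed₂] (n : ℕ),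
        (P.shift (1 : ℤ)).trW (E.map (homOfLE n.le_succ)) →
        P.trW (F.map (homOfLE n.le_succ)) → P.trW (z n) := by
  choose φ h₁ h₂ hP using fun n => exists_good_morphism (h n) (h (n + 1))
    (E.map (homOfLE n.le_succ)) (F.map (homOfLE n.le_succ)) (a.naturality _).symm
  refine ⟨fun n => (φ n).hom₃, fun n => ?_, fun n => ?_, fun P _ _ n => hP n P⟩
  · rw [← h₂]; exact (φ n).comm₂.symm
  · rw [← h₁]; exact (φ n).comm₃.symm

end Cones

namespace Metric

variable {C : Type u} [Category.{v} C] [Preadditive C] [HasZeroObject C] [HasShift C ℤ]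
  [∀ n : ℤ, (shiftFunctor C n).Additive] [Pretriangulated C] (μ : Metric C)

instance (i : ℕ) : (μ.M i).IsClosedUnderIsomorphisms := μ.isClosedUnderIsomorphisms i

instance (i : ℕ) : (μ.M i).ContainsZero := μ.containsZero i

instance (i : ℕ) : (μ.M i).IsTriangulatedClosed₂ :=
  .mk' fun T hT h₁ h₃ => by
    rw [← μ.extension i]
    exact ⟨_, _, _, _, _, hT, h₁, h₃⟩

instance (i : ℕ) (j : ℤ) : ((μ.M i).shift j).ContainsZero where
  exists_zero := ⟨0, isZero_zero C,
    (μ.M i).prop_of_isZero ((shiftFunctor C j).map_isZero (isZero_zero C))⟩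

lemma M_antitone : Antitone μ.M := antitone_nat_of_succ_le μ.antitone

variable {μ}

lemma IsCauchy.exists_trW {E : ℕ ⥤ C} (hE : μ.IsCauchy E) (i : ℕ) (j : ℤ) :
    ∃ N, ∀ (m m' : ℕ) (h : m ≤ m'), N ≤ m → ((μ.M i).shift j).trW (E.map (homOfLE h)) := by
  obtain ⟨N, hN⟩ := hE i j
  refine ⟨N, fun m m' h hm => ?_⟩
  obtain rfl | h' := h.eq_or_lt
  · have : IsIso (E.map (homOfLE h)) := by
      rw [Subsingleton.elim (homOfLE h) (𝟙 _)]
      infer_instance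
    exact ObjectProperty.trW_of_isIso _ _
  · obtain ⟨D, p, q, hD⟩ := distinguished_cocone_triangle (E.map (homOfLE h))
    exact ⟨D, p, q, hD, hN m m' h' hm D p q hD⟩

/-- It is enough to test the Cauchy condition on the transition morphisms `E n ⟶ E (n + 1)`. -/
lemma isCauchy_of_succ [IsTriangulated C] {E : ℕ ⥤ C}
    (hE : ∀ (i : ℕ) (j : ℤ), ∃ N : ℕ, ∀ n, N ≤ n →
      ((μ.M i).shift j).trW (E.map (homOfLE n.le_succ))) : μ.IsCauchy E := by
  intro i j
  obtain ⟨N, hN⟩ := hE i j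
  refine ⟨N, fun m m' h hm D p q hD => ?_⟩
  refine (((μ.M i).shift j).trW_iff_of_distinguished _ hD).1 ?_
  change ((μ.M i).shift j).trW (E.map (homOfLE h.le))
  clear hD p q
  induction m', h using Nat.le_induction with
  | base => exact hN m hm
  | succ k hk ih =>
    rw [← homOfLE_comp (show m ≤ k by lia) k.le_succ, E.map_comp]
    exact trW_comp _ ih (hN k (by lia))

end Metric

end MetricCompletion

/-! ### Presentations by Cauchy sequences, and local objects -/

namespace MetricCompletion

variable {C : Type u} [Category.{v} C] [Preadditive C] [HasZeroObject C] [HasShift C ℤ]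
  [∀ n : ℤ, (shiftFunctor C n).Additive] [Pretriangulated C]

namespace Metric

variable (μ : Metric C)

/-- A presentation of `A` as the colimit in `Mod C` of the Yoneda image of a Cauchy sequence. -/
structure Presentation (A : Modules C) where
  /-- the Cauchy sequence -/
  seq : ℕ ⥤ C
  cauchy : μ.IsCauchy seq
  /-- the colimit cocone -/
  ι : seq ⋙ yonedaModules C ⟶ (Functor.const ℕ).obj A
  /-- the universal property -/
  isColimit : IsColimit (Cocone.mk A ι)

variable {μ}

lemma cauchyColimits.nonempty_presentation {A : Modules C} (hA : μ.cauchyColimits A) :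
    Nonempty (μ.Presentation A) := by
  obtain ⟨E, hE, α, ⟨hα⟩⟩ := hA
  exact ⟨⟨E, hE, α, hα⟩⟩

lemma IsCauchy.reindex {E : ℕ ⥤ C} (hE : μ.IsCauchy E) {φ : ℕ → ℕ} (hφ : StrictMono φ) :
    μ.IsCauchy (hφ.monotone.functor ⋙ E) := by
  intro i j
  obtain ⟨N, hN⟩ := hE i j
  exact ⟨N, fun m m' h hm => hN (φ m) (φ m') (hφ h) (hm.trans (hφ.id_le m))⟩

namespace Presentation

variable {A B : Modules C} (p : μ.Presentation A)

lemma cauchyColimits {A : Modules C} (p : μ.Presentation A) : μ.cauchyColimits A := ⟨p.seq, p.cauchy, p.ι, ⟨p.isColimit⟩⟩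

/-- The morphism from a stage of the presenting sequence to the colimit. -/
def π (n : ℕ) : (yonedaModules C).obj (p.seq.obj n) ⟶ A := p.ι.app n

@[simp]
lemma w {m n : ℕ} (h : m ⟶ n) :
    (yonedaModules C).map (p.seq.map h) ≫ p.π n = p.π m :=
  cocone_w p.ι h

@[simp]
lemma w_assoc {m n : ℕ} (h : m ⟶ n) (x : A ⟶ B) :
    (yonedaModules C).map (p.seq.map h) ≫ p.π n ≫ x = p.π m ≫ x := by
  rw [← p.w h]
  exact (Category.assoc _ _ _).symm

lemma hom_ext {x y : A ⟶ B} (h : ∀ n, p.π n ≫ x = p.π n ≫ y) : x = y :=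
  p.isColimit.hom_ext h

/-- A strictly increasing sequence of indices gives another presentation. -/
@[simps]
noncomputable abbrev reindex {φ : ℕ → ℕ} (hφ : StrictMono φ) : μ.Presentation A where
  seq := hφ.monotone.functor ⋙ p.seq
  cauchy := p.cauchy.reindex hφ
  ι := Functor.whiskerLeft hφ.monotone.functor p.ι
  isColimit :=
    have : hφ.monotone.functor.Final :=
      (Monotone.final_functor_iff _).2 fun n => ⟨n, hφ.id_le n⟩
    (Functor.Final.isColimitWhiskerEquiv hφ.monotone.functor _).symm p.isColimit

/-- The shift of a presentation. -/
@[simps]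
noncomputable abbrev shift (n : ℤ) : μ.Presentation (A⟦n⟧) where
  seq := p.seq ⋙ shiftFunctor C n
  cauchy := p.cauchy.shift n
  ι := { app m := ((yonedaModules C).commShiftIso n).hom.app (p.seq.obj m) ≫ (p.ι.app m)⟦n⟧'
         naturality m m' h := by
          have := ((yonedaModules C).commShiftIso n).hom.naturality (p.seq.map h)
          dsimp at this ⊢
          rw [reassoc_of% this, ← Functor.map_comp, cocone_w p.ι, Category.comp_id] }
  isColimit := by
    let e : (p.seq ⋙ shiftFunctor C n) ⋙ yonedaModules C ≅
        (p.seq ⋙ yonedaModules C) ⋙ shiftFunctor (Modules C) n :=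
      Functor.isoWhiskerLeft p.seq ((yonedaModules C).commShiftIso n)
    exact (IsColimit.precomposeHomEquiv e _).symm
      (isColimitOfPreserves (shiftFunctor (Modules C) n) p.isColimit)

lemma shift_π (n : ℤ) (m : ℕ) : (p.shift n).π m =
    ((yonedaModules C).commShiftIso n).hom.app (p.seq.obj m) ≫ (p.π m)⟦n⟧' := rfl

lemma exists_factor {s : C} (x : (yonedaModules C).obj s ⟶ A) :
    ∃ (n : ℕ) (f : s ⟶ p.seq.obj n), (yonedaModules C).map f ≫ p.π n = x :=
  MetricCompletion.exists_factor p.isColimit x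

lemma exists_map_eq {s : C} {n : ℕ} {f g : s ⟶ p.seq.obj n}
    (h : (yonedaModules C).map f ≫ p.π n = (yonedaModules C).map g ≫ p.π n) :
    ∃ (m : ℕ) (hm : n ≤ m), f ≫ p.seq.map (homOfLE hm) = g ≫ p.seq.map (homOfLE hm) :=
  MetricCompletion.exists_map_eq p.isColimit h

end Presentation

/-- A colimit of representables is a cohomological functor on `C`. -/
lemma cauchyColimits.yoneda_exact₂ {B : Modules C} (hB : μ.cauchyColimits B) {X Y Z : C}
    {f : X ⟶ Y} {g : Y ⟶ Z} {h : Z ⟶ X⟦(1 : ℤ)⟧} (hT : Triangle.mk f g h ∈ distTriang C)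
    (x : (yonedaModules C).obj Y ⟶ B) (hx : (yonedaModules C).map f ≫ x = 0) :
    ∃ z : (yonedaModules C).obj Z ⟶ B, x = (yonedaModules C).map g ≫ z := by
  obtain ⟨q⟩ := hB.nonempty_presentation
  obtain ⟨n, y, rfl⟩ := q.exists_factor x
  obtain ⟨m, hm, hy⟩ := q.exists_map_eq (n := n) (f := f ≫ y) (g := 0) (by
    rw [Functor.map_comp, Category.assoc, hx, Functor.map_zero, zero_comp])
  rw [zero_comp, Category.assoc] at hy
  obtain ⟨(z : Z ⟶ q.seq.obj m), (hz : _ = g ≫ z)⟩ := Triangle.yoneda_exact₂ _ hT _ hy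
  refine ⟨(yonedaModules C).map z ≫ q.π m, ?_⟩
  rw [← Functor.map_comp_assoc, ← hz, Functor.map_comp_assoc, q.w]

variable (μ) in
/-- The objects of `𝔏(C)` on which `Hom(Y(X), -)` vanishes for `X` in `M i` and in `(M i)⟦-1⟧`. -/
def localObjects (i : ℕ) : ObjectProperty (Modules C) := fun B =>
  μ.cauchyColimits B ∧ ∀ X, μ.M i X → (∀ φ : (yonedaModules C).obj X ⟶ B, φ = 0) ∧
    ∀ φ : (yonedaModules C).obj (X⟦(-1 : ℤ)⟧) ⟶ B, φ = 0

lemma localObjects_monotone : Monotone μ.localObjects := fun _ _ h _ hB =>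
  ⟨hB.1, fun X hX => hB.2 X (μ.M_antitone h X hX)⟩

lemma completion.exists_localObjects {B : Modules C} (hB : μ.completion B) :
    ∃ i, μ.localObjects i B := by
  obtain ⟨i, hi⟩ := hB.2 0
  obtain ⟨j, hj⟩ := hB.2 (-1)
  refine ⟨max i j, hB.1, fun X hX => ⟨fun φ => ?_, fun φ =>
    hj X (μ.M_antitone (le_max_right i j) X hX) φ⟩⟩
  have := hi X (μ.M_antitone (le_max_left i j) X hX)
    ((yonedaModules C).map ((shiftFunctorZero C ℤ).hom.app X) ≫ φ)
  rwa [Preadditive.IsIso.comp_left_eq_zero] at this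

/-- A morphism of `C` with cone in `M i` is inverted by `Hom(Y(-), B)` for local `B`. -/
lemma isLocal_map_of_trW {i : ℕ} {X Y : C} {f : X ⟶ Y} (hf : (μ.M i).trW f) :
    (μ.localObjects i).isLocal ((yonedaModules C).map f) := by
  obtain ⟨Z, g, h, hT, hZ⟩ := hf
  refine fun B hB => ⟨fun y y' hyy' => ?_, fun x => ?_⟩
  · obtain ⟨z, hz⟩ := hB.1.yoneda_exact₂ hT (y - y')
      (by rw [Preadditive.comp_sub]; exact sub_eq_zero.2 hyy')
    rw [(hB.2 Z hZ).1 z, comp_zero, sub_eq_zero] at hz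
    exact hz
  · obtain ⟨z, hz⟩ := hB.1.yoneda_exact₂ (inv_rot_of_distTriang _ hT) x ((hB.2 Z hZ).2 _)
    exact ⟨z, hz.symm⟩

namespace Presentation

variable {A : Modules C} (p : μ.Presentation A)

/-- If the cones of the transition morphisms from stage `N` on lie in `M i`, then a morphism from
the colimit to a local object is determined by, and can be prescribed on, any of these stages. -/
lemma isLocal_π_of_trW {i N : ℕ}
    (h : ∀ (m m' : ℕ) (h : m ≤ m'), N ≤ m → (μ.M i).trW (p.seq.map (homOfLE h)))
    {n : ℕ} (hn : N ≤ n) : (μ.localObjects i).isLocal (p.π n) := by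
  intro B hB
  have loc (m m' : ℕ) (hm : m ≤ m') (hN : N ≤ m) := isLocal_map_of_trW (h m m' hm hN) B hB
  refine ⟨fun y y' hyy' => p.hom_ext fun k => ?_, fun x => ?_⟩
  · have : p.π (max n k) ≫ y = p.π (max n k) ≫ y' := by
      refine (loc n _ (le_max_left n k) hn).1 ?_
      dsimp only at hyy' ⊢
      rw [p.w_assoc, p.w_assoc, hyy']
    rw [← p.w (homOfLE (le_max_right n k)), Category.assoc, Category.assoc, this]
  · choose z hz using fun k => (loc n (n + k) (by lia) hn).2 x
    have hzz (k k' : ℕ) (hk : k ≤ k') :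
        (yonedaModules C).map (p.seq.map (homOfLE (show n + k ≤ n + k' by lia))) ≫ z k' = z k := by
      refine (loc n (n + k) (by lia) hn).1 ?_
      have h₁ := hz k
      have h₂ := hz k'
      dsimp only at h₁ h₂ ⊢
      rw [h₁, ← Functor.map_comp_assoc, ← Functor.map_comp, homOfLE_comp, h₂]
    let β : p.seq ⋙ yonedaModules C ⟶ (Functor.const ℕ).obj B :=
      { app k := (yonedaModules C).map (p.seq.map (homOfLE (show k ≤ n + k by lia))) ≫ z k
        naturality k k' f := by
          dsimp
          rw [Category.comp_id, ← hzz k k' (leOfHom f), ← Functor.map_comp_assoc,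
            ← Functor.map_comp_assoc, ← Functor.map_comp, ← Functor.map_comp]
          rfl }
    exact ⟨p.isColimit.desc (Cocone.mk B β), (p.isColimit.fac _ n).trans (hz n)⟩

lemma exists_isLocal_π (i : ℕ) : ∃ N, ∀ n, N ≤ n → (μ.localObjects i).isLocal (p.π n) := by
  obtain ⟨N, hN⟩ := p.cauchy.exists_trW i 0
  rw [ObjectProperty.shift_zero] at hN
  exact ⟨N, fun n hn => p.isLocal_π_of_trW hN hn⟩

end Presentation

end Metric

end MetricCompletion

/-! ### Presentations of triangles by Cauchy sequences of triangles -/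

namespace MetricCompletion

variable {C : Type u} [Category.{v} C] [Preadditive C] [HasZeroObject C] [HasShift C ℤ]
  [∀ n : ℤ, (shiftFunctor C n).Additive] [Pretriangulated C]

namespace Metric

variable {μ : Metric C}

namespace Presentation

variable {A B : Modules C} (p : μ.Presentation A) (q : μ.Presentation B) (f : A ⟶ B)

/-- Every morphism between objects with presentations lifts to the presenting sequences, after
the presentation of the target is reindexed. -/
lemma exists_lift : ∃ (φ : ℕ → ℕ) (hφ : StrictMono φ) (u : p.seq ⟶ (q.reindex hφ).seq),
    ∀ n, (yonedaModules C).map (u.app n) ≫ (q.reindex hφ).π n = p.π n ≫ f := by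
  let S (n : ℕ) := {x : Σ k, p.seq.obj n ⟶ q.seq.obj k //
    (yonedaModules C).map x.2 ≫ q.π x.1 = p.π n ≫ f}
  have step (n : ℕ) (x : S n) : ∃ (y : S (n + 1)) (hxy : x.1.1 < y.1.1),
      p.seq.map (homOfLE n.le_succ) ≫ y.1.2 = x.1.2 ≫ q.seq.map (homOfLE hxy.le) := by
    obtain ⟨⟨k, a⟩, ha⟩ := x
    obtain ⟨l, b, hb⟩ := q.exists_factor (p.π (n + 1) ≫ f)
    let m := max l (k + 1)
    have hkm : k ≤ m := by lia
    have hlm : l ≤ m := by lia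
    obtain ⟨m', hm', h⟩ := q.exists_map_eq (n := m)
      (f := p.seq.map (homOfLE n.le_succ) ≫ b ≫ q.seq.map (homOfLE hlm))
      (g := a ≫ q.seq.map (homOfLE hkm)) (by
        dsimp only at ha
        simp only [Functor.map_comp, Category.assoc, w, ha, hb, w_assoc])
    refine ⟨⟨⟨m', b ≫ q.seq.map (homOfLE (hlm.trans hm'))⟩, ?_⟩, ?_, ?_⟩
    · simp [hb]
    · dsimp; lia
    · rw [Category.assoc, Category.assoc, Category.assoc, ← Functor.map_comp,
        ← Functor.map_comp] at h
      exact h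
  choose next hlt hnext using step
  obtain ⟨k, a, ha⟩ := q.exists_factor (p.π 0 ≫ f)
  let s (n : ℕ) : S n := Nat.rec ⟨⟨k, a⟩, ha⟩ next n
  have hs : StrictMono fun n => (s n).1.1 := strictMono_nat_of_lt_succ fun n => hlt n (s n)
  exact ⟨_, hs, NatTrans.ofSequence (fun n => (s n).1.2) fun n => hnext n (s n),
    fun n => (s n).2⟩

variable {p q f}

lemma shift_comm {n m : ℕ} {u : p.seq.obj n ⟶ q.seq.obj m}
    (hu : (yonedaModules C).map u ≫ q.π m = p.π n ≫ f) (k : ℤ) :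
    (yonedaModules C).map (u⟦k⟧') ≫ (q.shift k).π m = (p.shift k).π n ≫ f⟦k⟧' := by
  have := ((yonedaModules C).commShiftIso k).hom.naturality u
  dsimp at this
  rw [shift_π, shift_π, reassoc_of% this, ← Functor.map_comp, hu, Functor.map_comp,
    Category.assoc]

end Presentation

/-- A presentation of a triangle `A ⟶ B ⟶ D ⟶ A⟦1⟧` in `Mod C` as the colimit of the Yoneda image
of a Cauchy sequence of distinguished triangles, on given presentations of its three vertices. -/
structure TrianglePresentation {A B D : Modules C} (f : A ⟶ B) (g : B ⟶ D) (h : D ⟶ A⟦(1 : ℤ)⟧)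
    (p : μ.Presentation A) (q : μ.Presentation B) (r : μ.Presentation D) where
  /-- the first morphisms of the triangles -/
  u : p.seq ⟶ q.seq
  /-- the second morphisms of the triangles -/
  v : q.seq ⟶ r.seq
  /-- the third morphisms of the triangles -/
  w : r.seq ⟶ p.seq ⋙ shiftFunctor C (1 : ℤ)
  dist (n : ℕ) : Triangle.mk (u.app n) (v.app n) (w.app n) ∈ distTriang C
  comm₁ (n : ℕ) : (yonedaModules C).map (u.app n) ≫ q.π n = p.π n ≫ f
  comm₂ (n : ℕ) : (yonedaModules C).map (v.app n) ≫ r.π n = q.π n ≫ g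
  comm₃ (n : ℕ) : (yonedaModules C).map (w.app n) ≫ (p.shift 1).π n = r.π n ≫ h

lemma IsColimitOfCauchyTriangles.exists_trianglePresentation {T : Triangle (Modules C)}
    (hT : μ.IsColimitOfCauchyTriangles T) :
    ∃ (p : μ.Presentation T.obj₁) (q : μ.Presentation T.obj₂) (r : μ.Presentation T.obj₃),
      Nonempty (TrianglePresentation T.mor₁ T.mor₂ T.mor₃ p q r) := by
  obtain ⟨t, ht, h₁, h₂, h₃, α, ⟨hα₁⟩, ⟨hα₂⟩, ⟨hα₃⟩⟩ := hT
  let p : μ.Presentation T.obj₁ := ⟨t ⋙ Triangle.π₁, h₁, Functor.whiskerRight α Triangle.π₁, hα₁⟩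
  let q : μ.Presentation T.obj₂ := ⟨t ⋙ Triangle.π₂, h₂, Functor.whiskerRight α Triangle.π₂, hα₂⟩
  let r : μ.Presentation T.obj₃ := ⟨t ⋙ Triangle.π₃, h₃, Functor.whiskerRight α Triangle.π₃, hα₃⟩
  refine ⟨p, q, r, ⟨⟨Functor.whiskerLeft t Triangle.π₁Toπ₂, Functor.whiskerLeft t Triangle.π₂Toπ₃,
    Functor.whiskerLeft t Triangle.π₃Toπ₁, ht, fun n => (α.app n).comm₁, fun n => (α.app n).comm₂,
    fun n => ?_⟩⟩⟩
  have := (α.app n).comm₃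
  exact (Category.assoc _ _ _).symm.trans this

namespace TrianglePresentation

variable {A B D : Modules C} {f : A ⟶ B} {g : B ⟶ D} {h : D ⟶ A⟦(1 : ℤ)⟧}
    {p : μ.Presentation A} {q : μ.Presentation B} {r : μ.Presentation D}

lemma isColimitOfCauchyTriangles (τ : TrianglePresentation f g h p q r) :
    μ.IsColimitOfCauchyTriangles (Triangle.mk f g h) := by
  refine ⟨Triangle.functorMk τ.u τ.v τ.w, τ.dist, p.cauchy, q.cauchy, r.cauchy,
    { app n :=
        { hom₁ := p.ι.app n
          hom₂ := q.ι.app n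
          hom₃ := r.ι.app n
          comm₁ := τ.comm₁ n
          comm₂ := τ.comm₂ n
          comm₃ := (Category.assoc _ _ _).trans (τ.comm₃ n) }
      naturality m n k := by
        apply Triangle.hom_ext
        · exact p.ι.naturality k
        · exact q.ι.naturality k
        · exact r.ι.naturality k }, ⟨p.isColimit⟩, ⟨q.isColimit⟩, ⟨r.isColimit⟩⟩

/-- A colimit of distinguished triangles is exact at its third vertex. -/
lemma exact₃ (τ : TrianglePresentation f g h p q r) {s : C}
    (x : (yonedaModules C).obj s ⟶ D) (hx : x ≫ h = 0) :
    ∃ y : (yonedaModules C).obj s ⟶ B, x = y ≫ g := by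
  obtain ⟨n, z, rfl⟩ := r.exists_factor x
  obtain ⟨m, hm, hz⟩ := (p.shift 1).exists_map_eq (n := n) (f := z ≫ τ.w.app n) (g := 0) (by
    rw [Functor.map_comp, Category.assoc, τ.comm₃, Functor.map_zero, zero_comp,
      ← Category.assoc, hx])
  have hw := τ.w.naturality (homOfLE hm)
  dsimp at hz hw
  rw [zero_comp, Category.assoc, ← hw, ← Category.assoc] at hz
  obtain ⟨(y : s ⟶ q.seq.obj m), (hy : _ = y ≫ τ.v.app m)⟩ :=
    Triangle.coyoneda_exact₃ _ (τ.dist m) _ hz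
  refine ⟨(yonedaModules C).map y ≫ q.π m, ?_⟩
  rw [Category.assoc, ← τ.comm₂, ← Functor.map_comp_assoc, ← hy, Functor.map_comp_assoc, r.w]

lemma eq_zero_of_exact₃ (τ : TrianglePresentation f g h p q r) {s : C}
    (hB : ∀ φ : (yonedaModules C).obj s ⟶ B, φ = 0)
    (hA : ∀ φ : (yonedaModules C).obj s ⟶ A⟦(1 : ℤ)⟧, φ = 0)
    (φ : (yonedaModules C).obj s ⟶ D) : φ = 0 := by
  obtain ⟨y, rfl⟩ := τ.exact₃ φ (hA _)
  rw [hB y, zero_comp]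

lemma localObjects₃ (τ : TrianglePresentation f g h p q r) {i : ℕ}
    (hB : μ.localObjects i B) (hA : μ.localObjects i (A⟦(1 : ℤ)⟧)) :
    μ.localObjects i D :=
  ⟨r.cauchyColimits, fun X hX => ⟨τ.eq_zero_of_exact₃ (hB.2 X hX).1 (hA.2 X hX).1,
    τ.eq_zero_of_exact₃ (hB.2 X hX).2 (hA.2 X hX).2⟩⟩

lemma completion₃ (τ : TrianglePresentation f g h p q r)
    (hA : μ.completion A) (hB : μ.completion B) : μ.completion D := by
  refine ⟨r.cauchyColimits, fun j => ?_⟩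
  obtain ⟨i, hi⟩ := hB.2 j
  obtain ⟨i', hi'⟩ := (μ.completion.le_shift (1 : ℤ) A hA).2 j
  exact ⟨max i i', fun X hX => τ.eq_zero_of_exact₃ (hi X (μ.M_antitone (le_max_left i i') X hX))
    (hi' X (μ.M_antitone (le_max_right i i') X hX))⟩

end TrianglePresentation

/-- Compatible morphisms of Cauchy sequences are part of a Cauchy sequence of distinguished
triangles, and these have a colimit. -/
lemma exists_trianglePresentation [IsTriangulated C] {A B : Modules C} {f : A ⟶ B}
    (p : μ.Presentation A) (q : μ.Presentation B) (u : p.seq ⟶ q.seq)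
    (hu : ∀ n, (yonedaModules C).map (u.app n) ≫ q.π n = p.π n ≫ f) :
    ∃ (D : Modules C) (g : B ⟶ D) (h : D ⟶ A⟦(1 : ℤ)⟧) (r : μ.Presentation D)
      (τ : TrianglePresentation f g h p q r), τ.u = u := by
  choose Z b c hT using fun n => distinguished_cocone_triangle (u.app n)
  obtain ⟨z, hb, hc, hz⟩ := exists_transition u b c hT
  let G : ℕ ⥤ C := Functor.ofSequence z
  let v : q.seq ⟶ G := NatTrans.ofSequence b fun n =>
    (hb n).trans (by rw [Functor.ofSequence_map_homOfLE_succ]; rfl)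
  let w : G ⟶ p.seq ⋙ shiftFunctor C (1 : ℤ) := NatTrans.ofSequence c fun n => by
    rw [Functor.ofSequence_map_homOfLE_succ]
    exact hc n
  have hG : μ.IsCauchy G := isCauchy_of_succ fun i j => by
    obtain ⟨N₁, h₁⟩ := p.cauchy.exists_trW i (1 + j)
    obtain ⟨N₂, h₂⟩ := q.cauchy.exists_trW i j
    refine ⟨max N₁ N₂, fun n hn => ?_⟩
    rw [Functor.ofSequence_map_homOfLE_succ]
    refine hz _ n ?_ (h₂ _ _ _ (by lia))
    rw [ObjectProperty.shift_shift _ _ _ _ rfl]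
    exact h₁ _ _ _ (by lia)
  let r : μ.Presentation (colimit (G ⋙ yonedaModules C)) :=
    ⟨G, hG, (colimit.cocone _).ι, colimit.isColimit _⟩
  let gc : Cocone (q.seq ⋙ yonedaModules C) :=
    Cocone.mk _ (Functor.whiskerRight v (yonedaModules C) ≫ r.ι)
  let g : B ⟶ colimit (G ⋙ yonedaModules C) := q.isColimit.desc gc
  let hc : Cocone (r.seq ⋙ yonedaModules C) :=
    Cocone.mk _ (Functor.whiskerRight w (yonedaModules C) ≫ (p.shift 1).ι)
  let h : colimit (G ⋙ yonedaModules C) ⟶ A⟦(1 : ℤ)⟧ := r.isColimit.desc hc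
  exact ⟨_, g, h, r, ⟨u, v, w, hT, hu, fun n => (q.isColimit.fac gc n).symm,
    fun n => (r.isColimit.fac hc n).symm⟩, rfl⟩

end Metric

end MetricCompletion

/-! ### Rotation, cones and completion of morphisms in the module category -/

namespace MetricCompletion

variable {C : Type u} [Category.{v} C] [Preadditive C] [HasZeroObject C] [HasShift C ℤ]
  [∀ n : ℤ, (shiftFunctor C n).Additive] [Pretriangulated C]

namespace Metric

variable {μ : Metric C}

namespace IsColimitOfCauchyTriangles

variable {T T' : Triangle (Modules C)}

lemma of_iso (hT : μ.IsColimitOfCauchyTriangles T) (e : T ≅ T') :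
    μ.IsColimitOfCauchyTriangles T' := by
  obtain ⟨t, ht, h₁, h₂, h₃, α, ⟨hα₁⟩, ⟨hα₂⟩, ⟨hα₃⟩⟩ := hT
  exact ⟨t, ht, h₁, h₂, h₃, α ≫ (Functor.const ℕ).map e.hom,
    ⟨hα₁.ofIsoColimit (Cocone.ext (Triangle.π₁.mapIso e) fun _ => rfl)⟩,
    ⟨hα₂.ofIsoColimit (Cocone.ext (Triangle.π₂.mapIso e) fun _ => rfl)⟩,
    ⟨hα₃.ofIsoColimit (Cocone.ext (Triangle.π₃.mapIso e) fun _ => rfl)⟩⟩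

lemma rotate (hT : μ.IsColimitOfCauchyTriangles T) :
    μ.IsColimitOfCauchyTriangles T.rotate := by
  obtain ⟨t, ht, h₁, h₂, h₃, α, ⟨hα₁⟩, ⟨hα₂⟩, ⟨hα₃⟩⟩ := hT
  let p : μ.Presentation T.obj₁ := ⟨t ⋙ Triangle.π₁, h₁, Functor.whiskerRight α Triangle.π₁, hα₁⟩
  refine ⟨t ⋙ Pretriangulated.rotate C, fun m => rot_of_distTriang _ (ht m), h₂, h₃, h₁.shift 1,
    Functor.whiskerLeft t (yonedaModules C).mapTriangleRotateIso.inv ≫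
      Functor.whiskerRight α (Pretriangulated.rotate _) ≫
      { app := fun _ => 𝟙 T.rotate }, ⟨?_⟩, ⟨?_⟩, ⟨?_⟩⟩
  · exact hα₂.ofIsoColimit (Cocone.ext (Iso.refl _) fun n => (Category.comp_id _).trans
      ((Category.id_comp _).trans (Category.comp_id _)).symm)
  · exact hα₃.ofIsoColimit (Cocone.ext (Iso.refl _) fun n => (Category.comp_id _).trans
      ((Category.id_comp _).trans (Category.comp_id _)).symm)
  · exact (p.shift 1).isColimit.ofIsoColimit (Cocone.ext (Iso.refl _) fun n =>
      (Category.comp_id _).trans (congrArg (_ ≫ ·) (Category.comp_id _)).symm)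

lemma invRotate (hT : μ.IsColimitOfCauchyTriangles T) :
    μ.IsColimitOfCauchyTriangles T.invRotate := by
  obtain ⟨t, ht, h₁, h₂, h₃, α, ⟨hα₁⟩, ⟨hα₂⟩, ⟨hα₃⟩⟩ := hT
  let r : μ.Presentation T.obj₃ := ⟨t ⋙ Triangle.π₃, h₃, Functor.whiskerRight α Triangle.π₃, hα₃⟩
  refine ⟨t ⋙ Pretriangulated.invRotate C, fun m => inv_rot_of_distTriang _ (ht m),
    h₃.shift (-1), h₁, h₂,
    Functor.whiskerLeft t (yonedaModules C).mapTriangleInvRotateIso.inv ≫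
      Functor.whiskerRight α (Pretriangulated.invRotate _) ≫
      { app := fun _ => 𝟙 T.invRotate }, ⟨?_⟩, ⟨?_⟩, ⟨?_⟩⟩
  · exact (r.shift (-1)).isColimit.ofIsoColimit (Cocone.ext (Iso.refl _) fun n =>
      (Category.comp_id _).trans (congrArg (_ ≫ ·) (Category.comp_id _)).symm)
  · exact hα₁.ofIsoColimit (Cocone.ext (Iso.refl _) fun n => (Category.comp_id _).trans
      ((Category.id_comp _).trans (Category.comp_id _)).symm)
  · exact hα₂.ofIsoColimit (Cocone.ext (Iso.refl _) fun n => (Category.comp_id _).trans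
      ((Category.id_comp _).trans (Category.comp_id _)).symm)

end IsColimitOfCauchyTriangles

/-- Every morphism of `𝔖(C)` is part of a colimit of Cauchy sequences of triangles. -/
lemma exists_isColimitOfCauchyTriangles [IsTriangulated C] {A B : Modules C}
    (hA : μ.completion A) (hB : μ.completion B) (f : A ⟶ B) :
    ∃ (D : Modules C) (_ : μ.completion D) (g : B ⟶ D) (h : D ⟶ A⟦(1 : ℤ)⟧),
      μ.IsColimitOfCauchyTriangles (Triangle.mk f g h) := by
  obtain ⟨p⟩ := hA.1.nonempty_presentation
  obtain ⟨q⟩ := hB.1.nonempty_presentation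
  obtain ⟨φ, hφ, u, hu⟩ := p.exists_lift q f
  obtain ⟨D, g, h, r, τ, -⟩ := exists_trianglePresentation p (q.reindex hφ) u hu
  exact ⟨D, τ.completion₃ hA hB, g, h, τ.isColimitOfCauchyTriangles⟩

lemma isColimitOfCauchyTriangles_id [IsTriangulated C] {A D : Modules C}
    (hA : μ.cauchyColimits A) (hD : IsZero D) :
    μ.IsColimitOfCauchyTriangles (Triangle.mk (𝟙 A) (0 : A ⟶ D) 0) := by
  obtain ⟨p⟩ := hA.nonempty_presentation
  obtain ⟨D', g, h, r, τ, hτ⟩ := exists_trianglePresentation (f := 𝟙 A) p p (𝟙 _) fun n => by simp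
  have hr (n : ℕ) : IsZero (r.seq.obj n) := Triangle.isZero₃_of_isIso₁ _ (τ.dist n) (by
    rw [hτ]
    exact inferInstanceAs (IsIso (𝟙 (p.seq.obj n))))
  have hD' : IsZero D' := (IsZero.iff_id_eq_zero _).2 (r.hom_ext fun n =>
    ((yonedaModules C).map_isZero (hr n)).eq_of_src _ _)
  exact τ.isColimitOfCauchyTriangles.of_iso (Triangle.isoMk _ _ (Iso.refl _) (Iso.refl _)
    (hD'.iso hD) rfl (hD.eq_of_tgt _ _) (hD'.eq_of_src _ _))

/-- Morphisms of triangles can be completed: as `T'.obj₃` and `T'.obj₁⟦1⟧` are compactly supported,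
it is enough to complete at a single stage, where this is the axiom in `C`. -/
lemma IsColimitOfCauchyTriangles.complete_morphism {T T' : Triangle (Modules C)}
    (hT : μ.IsColimitOfCauchyTriangles T) (hT' : μ.IsColimitOfCauchyTriangles T')
    (hA : μ.completion T'.obj₁) (hD : μ.completion T'.obj₃)
    (a : T.obj₁ ⟶ T'.obj₁) (b : T.obj₂ ⟶ T'.obj₂) (hab : T.mor₁ ≫ b = a ≫ T'.mor₁) :
    ∃ c : T.obj₃ ⟶ T'.obj₃, T.mor₂ ≫ c = b ≫ T'.mor₂ ∧ T.mor₃ ≫ a⟦(1 : ℤ)⟧' = c ≫ T'.mor₃ := by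
  obtain ⟨p, q, r, ⟨τ⟩⟩ := hT.exists_trianglePresentation
  obtain ⟨p', q', r', ⟨τ'⟩⟩ := hT'.exists_trianglePresentation
  obtain ⟨i₁, hi₁⟩ := hD.exists_localObjects
  obtain ⟨i₂, hi₂⟩ := completion.exists_localObjects (μ.completion.le_shift (1 : ℤ) _ hA)
  replace hi₁ := localObjects_monotone (le_max_left i₁ i₂) _ hi₁
  replace hi₂ := localObjects_monotone (le_max_right i₁ i₂) _ hi₂
  obtain ⟨N₁, h₁⟩ := q.exists_isLocal_π (max i₁ i₂)
  obtain ⟨N₂, h₂⟩ := r.exists_isLocal_π (max i₁ i₂)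
  let n := max N₁ N₂
  replace h₁ := h₁ n (by lia)
  replace h₂ := h₂ n (by lia)
  -- The morphisms `a` and `b` at stage `n` commute with the triangles in the colimit, hence at
  -- a late enough stage `m` of the target.
  obtain ⟨m, x, y, hx, hy, hxy⟩ : ∃ (m : ℕ) (x : p.seq.obj n ⟶ p'.seq.obj m)
      (y : q.seq.obj n ⟶ q'.seq.obj m), (yonedaModules C).map x ≫ p'.π m = p.π n ≫ a ∧
      (yonedaModules C).map y ≫ q'.π m = q.π n ≫ b ∧ τ.u.app n ≫ y = x ≫ τ'.u.app m := by
    obtain ⟨k, x, hx⟩ := p'.exists_factor (p.π n ≫ a)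
    obtain ⟨l, y, hy⟩ := q'.exists_factor (q.π n ≫ b)
    obtain ⟨m, hm, hxy⟩ := q'.exists_map_eq (n := max k l)
      (f := τ.u.app n ≫ y ≫ q'.seq.map (homOfLE (le_max_right k l)))
      (g := x ≫ p'.seq.map (homOfLE (le_max_left k l)) ≫ τ'.u.app _) (by
        simp only [Functor.map_comp, Category.assoc, q'.w, hy, τ'.comm₁, p'.w_assoc]
        rw [reassoc_of% τ.comm₁, reassoc_of% hx, hab])
    refine ⟨m, x ≫ p'.seq.map (homOfLE ((le_max_left k l).trans hm)),
      y ≫ q'.seq.map (homOfLE ((le_max_right k l).trans hm)), ?_, ?_, ?_⟩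
    · rw [Functor.map_comp_assoc, p'.w, hx]
    · rw [Functor.map_comp_assoc, q'.w, hy]
    · simp only [Category.assoc] at hxy ⊢
      rw [← τ'.u.naturality, ← Functor.map_comp, ← Functor.map_comp_assoc] at hxy
      exact hxy
  obtain ⟨(z : r.seq.obj n ⟶ r'.seq.obj m), (hz₁ : τ.v.app n ≫ z = y ≫ τ'.v.app m),
      (hz₂ : τ.w.app n ≫ x⟦(1 : ℤ)⟧' = z ≫ τ'.w.app m)⟩ :=
    Pretriangulated.complete_distinguished_triangle_morphism _ _ (τ.dist n) (τ'.dist m) x y hxy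
  obtain ⟨c, hc⟩ := (h₂ _ hi₁).2 ((yonedaModules C).map z ≫ r'.π m)
  dsimp at hc
  refine ⟨c, (h₁ _ hi₁).1 ?_, (h₂ _ hi₂).1 ?_⟩
  · dsimp
    rw [← reassoc_of% τ.comm₂, hc, ← Functor.map_comp_assoc, hz₁, Functor.map_comp_assoc,
      τ'.comm₂, reassoc_of% hy]
  · dsimp
    rw [reassoc_of% hc, ← τ'.comm₃, ← Functor.map_comp_assoc, ← hz₂, Functor.map_comp_assoc,
      Presentation.shift_comm hx, reassoc_of% τ.comm₃]

end Metric

end MetricCompletion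

/-! ### The octahedral axiom in the module category -/

namespace MetricCompletion

variable {C : Type u} [Category.{v} C] [Preadditive C] [HasZeroObject C] [HasShift C ℤ]
  [∀ n : ℤ, (shiftFunctor C n).Additive] [Pretriangulated C] [IsTriangulated C]

namespace Metric

variable {μ : Metric C}

/-- A criterion for a triangle `f, g, h` of `Mod C` to be a colimit of Cauchy sequences of
triangles: it is enough that one distinguished triangle `a, b, c` of `C`, on late stages of
presentations of the first two vertices, maps to it in such a way that the third component `d` is
inverted by `Hom(-, B)` for the local objects `B`. Indeed the cone of `f` obtained from the
presenting sequences has the same universal property as the third vertex. -/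
lemma isColimitOfCauchyTriangles_of_isLocal {i N : ℕ} {A B D : Modules C}
    (p : μ.Presentation A) (q : μ.Presentation B)
    (hp : ∀ (m m' : ℕ) (h : m ≤ m'), N ≤ m → ((μ.M i).shift (1 : ℤ)).trW (p.seq.map (homOfLE h)))
    (hq : ∀ (m m' : ℕ) (h : m ≤ m'), N ≤ m → (μ.M i).trW (q.seq.map (homOfLE h)))
    (hA : μ.localObjects i (A⟦(1 : ℤ)⟧)) (hB : μ.localObjects i B) (hD : μ.localObjects i D)
    {Z : C} {a : p.seq.obj N ⟶ q.seq.obj N} {b : q.seq.obj N ⟶ Z}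
    {c : Z ⟶ (p.seq.obj N)⟦(1 : ℤ)⟧} (hT : Triangle.mk a b c ∈ distTriang C)
    {f : A ⟶ B} {g : B ⟶ D} {h : D ⟶ A⟦(1 : ℤ)⟧} {d : (yonedaModules C).obj Z ⟶ D}
    (hd : (μ.localObjects i).isLocal d)
    (hf : (yonedaModules C).map a ≫ q.π N = p.π N ≫ f)
    (hg : (yonedaModules C).map b ≫ d = q.π N ≫ g)
    (hh : (yonedaModules C).map c ≫ (p.shift 1).π N = d ≫ h) :
    μ.IsColimitOfCauchyTriangles (Triangle.mk f g h) := by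
  obtain ⟨φ, hφ, u, hu⟩ := p.exists_lift q f
  obtain ⟨Q, g', h', r, τ, rfl⟩ := exists_trianglePresentation p (q.reindex hφ) u hu
  have hQ : μ.localObjects i Q := τ.localObjects₃ hB hA
  obtain ⟨k₀, hk₀⟩ := r.exists_isLocal_π i
  -- A stage `k` of the triangles presenting `Q` to which the given triangle maps.
  obtain ⟨k, hNk, hk, j, hj, hjπ, haj⟩ : ∃ (k : ℕ) (hNk : N ≤ k) (_ : k₀ ≤ k)
      (j : q.seq.obj N ⟶ (q.reindex hφ).seq.obj k), (μ.M i).trW j ∧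
      (yonedaModules C).map j ≫ (q.reindex hφ).π k = q.π N ∧
      a ≫ j = p.seq.map (homOfLE hNk) ≫ τ.u.app k := by
    let l := max N k₀
    have hl : N ≤ l := le_max_left _ _
    obtain ⟨k, hlk, hk⟩ := (q.reindex hφ).exists_map_eq (n := l)
      (f := a ≫ q.seq.map (homOfLE (hl.trans (hφ.id_le l))))
      (g := p.seq.map (homOfLE hl) ≫ τ.u.app l) (by
        rw [Functor.map_comp_assoc, Functor.map_comp_assoc, τ.comm₁, p.w_assoc, ← hf]
        congr 1
        exact q.w _)
    have hNk : N ≤ k := hl.trans hlk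
    refine ⟨k, hNk, (le_max_right _ _).trans hlk, q.seq.map (homOfLE (hNk.trans (hφ.id_le k))),
      hq _ _ _ le_rfl, q.w _, ?_⟩
    rw [Category.assoc, Category.assoc, ← τ.u.naturality, ← Functor.map_comp_assoc] at hk
    refine .trans ?_ hk
    congr 1
    exact q.seq.map_comp _ _
  obtain ⟨ψ, hψ₁, hψ₂, hψ⟩ := exists_good_morphism hT (τ.dist k) (p.seq.map (homOfLE hNk)) j haj
  let e : Z ⟶ r.seq.obj k := ψ.hom₃
  have he : (μ.M i).trW e := hψ _ (hp _ _ _ le_rfl) hj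
  have he₂ : b ≫ e = j ≫ τ.v.app k := by
    rw [← hψ₂]; exact ψ.comm₂
  have he₃ : e ≫ τ.w.app k = c ≫ (p.seq.map (homOfLE hNk))⟦(1 : ℤ)⟧' := by
    rw [← hψ₁]; exact ψ.comm₃.symm
  -- As `Y(Z) ⟶ D` and `Y(Z) ⟶ Q` have the same universal property, `D` and `Q` are isomorphic.
  let d' : (yonedaModules C).obj Z ⟶ Q := (yonedaModules C).map e ≫ r.π k
  have hd' : (μ.localObjects i).isLocal d' :=
    (μ.localObjects i).isLocal.comp_mem _ _ (isLocal_map_of_trW he) (hk₀ k hk)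
  have hg' : (yonedaModules C).map b ≫ d' = q.π N ≫ g' := by
    dsimp only [d']
    rw [← Functor.map_comp_assoc, he₂, Functor.map_comp_assoc, τ.comm₂, reassoc_of% hjπ]
  have hh' : (yonedaModules C).map c ≫ (p.shift 1).π N = d' ≫ h' := by
    dsimp only [d']
    rw [Category.assoc, ← τ.comm₃, ← Functor.map_comp_assoc, he₃, Functor.map_comp_assoc]
    congr 1
    exact ((p.shift 1).w (homOfLE hNk)).symm
  obtain ⟨x, hx⟩ := (hd _ hQ).2 d'
  obtain ⟨y, hy⟩ := (hd' _ hD).2 d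
  dsimp only at hx hy
  let iso : Q ≅ D :=
    { hom := y
      inv := x
      hom_inv_id := (hd' _ hQ).1 (by
        dsimp only
        rw [reassoc_of% hy, hx, Category.comp_id])
      inv_hom_id := (hd _ hD).1 (by
        dsimp only
        rw [reassoc_of% hx, hy, Category.comp_id]) }
  have hgy : g' ≫ y = g := (q.isLocal_π_of_trW hq le_rfl _ hD).1 (by
    dsimp only
    rw [← reassoc_of% hg', hy, hg])
  have hhy : h' = y ≫ h := (hd' _ hA).1 (by
    dsimp only
    rw [reassoc_of% hy, ← hh', hh])
  exact τ.isColimitOfCauchyTriangles.of_iso (Triangle.isoMk (Triangle.mk f g' h')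
    (Triangle.mk f g h) (Iso.refl _) (Iso.refl _) iso
    ((Category.comp_id _).trans (Category.id_comp _).symm)
    (hgy.trans (Category.id_comp _).symm)
    ((congrArg (h' ≫ ·) (CategoryTheory.Functor.map_id _ _)).trans ((Category.comp_id _).trans hhy)))

/-- The octahedral axiom, in terms of morphisms of `Mod C`: the octahedron of `C` at a late stage
of presenting sequences extends to the colimits, as the vertices of the colimit octahedron are
compactly supported. -/
lemma exists_octahedron {X₁ X₂ X₃ : Modules C} (h₁ : μ.completion X₁) (h₂ : μ.completion X₂)
    (h₃ : μ.completion X₃) (u₁₂ : X₁ ⟶ X₂) (u₂₃ : X₂ ⟶ X₃) :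
    ∃ (Z₁₂ Z₂₃ Z₁₃ : Modules C) (_ : μ.completion Z₁₂) (_ : μ.completion Z₂₃)
      (_ : μ.completion Z₁₃) (v₁₂ : X₂ ⟶ Z₁₂) (w₁₂ : Z₁₂ ⟶ X₁⟦(1 : ℤ)⟧)
      (v₂₃ : X₃ ⟶ Z₂₃) (w₂₃ : Z₂₃ ⟶ X₂⟦(1 : ℤ)⟧) (v₁₃ : X₃ ⟶ Z₁₃) (w₁₃ : Z₁₃ ⟶ X₁⟦(1 : ℤ)⟧)
      (m₁ : Z₁₂ ⟶ Z₁₃) (m₃ : Z₁₃ ⟶ Z₂₃),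
      μ.IsColimitOfCauchyTriangles (Triangle.mk u₁₂ v₁₂ w₁₂) ∧
      μ.IsColimitOfCauchyTriangles (Triangle.mk u₂₃ v₂₃ w₂₃) ∧
      μ.IsColimitOfCauchyTriangles (Triangle.mk (u₁₂ ≫ u₂₃) v₁₃ w₁₃) ∧
      v₁₂ ≫ m₁ = u₂₃ ≫ v₁₃ ∧ m₁ ≫ w₁₃ = w₁₂ ∧ v₁₃ ≫ m₃ = v₂₃ ∧
      w₁₃ ≫ u₁₂⟦(1 : ℤ)⟧' = m₃ ≫ w₂₃ ∧
      μ.IsColimitOfCauchyTriangles (Triangle.mk m₁ m₃ (w₂₃ ≫ v₁₂⟦(1 : ℤ)⟧')) := by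
  obtain ⟨p₁⟩ := h₁.1.nonempty_presentation
  obtain ⟨p₂, a, ha⟩ : ∃ (p₂ : μ.Presentation X₂) (a : p₁.seq ⟶ p₂.seq),
      ∀ n, (yonedaModules C).map (a.app n) ≫ p₂.π n = p₁.π n ≫ u₁₂ := by
    obtain ⟨q⟩ := h₂.1.nonempty_presentation
    obtain ⟨φ, hφ, a, ha⟩ := p₁.exists_lift q u₁₂
    exact ⟨_, a, ha⟩
  obtain ⟨p₃, b, hb⟩ : ∃ (p₃ : μ.Presentation X₃) (b : p₂.seq ⟶ p₃.seq),
      ∀ n, (yonedaModules C).map (b.app n) ≫ p₃.π n = p₂.π n ≫ u₂₃ := by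
    obtain ⟨q⟩ := h₃.1.nonempty_presentation
    obtain ⟨φ, hφ, a, ha⟩ := p₂.exists_lift q u₂₃
    exact ⟨_, a, ha⟩
  obtain ⟨Z₁₂, v₁₂, w₁₂, r₁₂, τ₁₂, rfl⟩ := exists_trianglePresentation p₁ p₂ a ha
  obtain ⟨Z₂₃, v₂₃, w₂₃, r₂₃, τ₂₃, rfl⟩ := exists_trianglePresentation p₂ p₃ b hb
  obtain ⟨Z₁₃, v₁₃, w₁₃, r₁₃, τ₁₃, hτ₁₃⟩ := exists_trianglePresentation (f := u₁₂ ≫ u₂₃) p₁ p₃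
    (τ₁₂.u ≫ τ₂₃.u) fun n => by
      rw [NatTrans.comp_app, Functor.map_comp_assoc, τ₂₃.comm₁, reassoc_of% τ₁₂.comm₁]
  have hZ₁₂ := τ₁₂.completion₃ h₁ h₂
  have hZ₂₃ := τ₂₃.completion₃ h₂ h₃
  have hZ₁₃ := τ₁₃.completion₃ h₁ h₃
  -- An index `i` for which all objects involved are local, and a stage `N` from which on the
  -- cones of the transition morphisms lie in `M i`.
  obtain ⟨i, hX₁, hX₂, hZ₁₂', hZ₁₃', hZ₂₃'⟩ : ∃ i, μ.localObjects i (X₁⟦(1 : ℤ)⟧) ∧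
      μ.localObjects i (X₂⟦(1 : ℤ)⟧) ∧ μ.localObjects i (Z₁₂⟦(1 : ℤ)⟧) ∧
      μ.localObjects i Z₁₃ ∧ μ.localObjects i Z₂₃ := by
    obtain ⟨i₁, hi₁⟩ := completion.exists_localObjects (μ.completion.le_shift (1 : ℤ) _ h₁)
    obtain ⟨i₂, hi₂⟩ := completion.exists_localObjects (μ.completion.le_shift (1 : ℤ) _ h₂)
    obtain ⟨i₃, hi₃⟩ := completion.exists_localObjects (μ.completion.le_shift (1 : ℤ) _ hZ₁₂)
    obtain ⟨i₄, hi₄⟩ := hZ₁₃.exists_localObjects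
    obtain ⟨i₅, hi₅⟩ := hZ₂₃.exists_localObjects
    let i := i₁ + i₂ + i₃ + i₄ + i₅
    exact ⟨i, localObjects_monotone (by lia : i₁ ≤ i) _ hi₁,
      localObjects_monotone (by lia : i₂ ≤ i) _ hi₂,
      localObjects_monotone (by lia : i₃ ≤ i) _ hi₃,
      localObjects_monotone (by lia : i₄ ≤ i) _ hi₄,
      localObjects_monotone (by lia : i₅ ≤ i) _ hi₅⟩
  obtain ⟨N, hp₂, hp₃, hr₁₂, hr₂₃, hr₁₂', hr₁₃'⟩ : ∃ N : ℕ,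
      (μ.localObjects i).isLocal (p₂.π N) ∧ (μ.localObjects i).isLocal (p₃.π N) ∧
      (μ.localObjects i).isLocal (r₁₂.π N) ∧ (μ.localObjects i).isLocal (r₂₃.π N) ∧
      (∀ (m m' : ℕ) (h : m ≤ m'), N ≤ m →
        ((μ.M i).shift (1 : ℤ)).trW (r₁₂.seq.map (homOfLE h))) ∧
      (∀ (m m' : ℕ) (h : m ≤ m'), N ≤ m → (μ.M i).trW (r₁₃.seq.map (homOfLE h))) := by
    obtain ⟨N₁, hN₁⟩ := p₂.exists_isLocal_π i
    obtain ⟨N₂, hN₂⟩ := p₃.exists_isLocal_π i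
    obtain ⟨N₃, hN₃⟩ := r₁₂.exists_isLocal_π i
    obtain ⟨N₄, hN₄⟩ := r₂₃.exists_isLocal_π i
    obtain ⟨N₅, hN₅⟩ := r₁₂.cauchy.exists_trW i 1
    obtain ⟨N₆, hN₆⟩ := r₁₃.cauchy.exists_trW i 0
    rw [ObjectProperty.shift_zero] at hN₆
    exact ⟨N₁ + N₂ + N₃ + N₄ + N₅ + N₆, hN₁ _ (by lia), hN₂ _ (by lia), hN₃ _ (by lia),
      hN₄ _ (by lia), fun m m' h hm => hN₅ m m' h (by lia), fun m m' h hm => hN₆ m m' h (by lia)⟩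
  have hr₁₃ := r₁₃.isLocal_π_of_trW hr₁₃' le_rfl
  have hτ₁₃N : τ₁₂.u.app N ≫ τ₂₃.u.app N = τ₁₃.u.app N := by rw [hτ₁₃]; rfl
  let O := Triangulated.someOctahedron hτ₁₃N (τ₁₂.dist N) (τ₂₃.dist N) (τ₁₃.dist N)
  obtain ⟨m₁, hm₁⟩ := (hr₁₂ _ hZ₁₃').2 ((yonedaModules C).map O.m₁ ≫ r₁₃.π N)
  obtain ⟨m₃, hm₃⟩ := (hr₁₃ _ hZ₂₃').2 ((yonedaModules C).map O.m₃ ≫ r₂₃.π N)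
  dsimp only at hm₁ hm₃
  refine ⟨Z₁₂, Z₂₃, Z₁₃, hZ₁₂, hZ₂₃, hZ₁₃, v₁₂, w₁₂, v₂₃, w₂₃, v₁₃, w₁₃, m₁, m₃,
    τ₁₂.isColimitOfCauchyTriangles, τ₂₃.isColimitOfCauchyTriangles,
    τ₁₃.isColimitOfCauchyTriangles, (hp₂ _ hZ₁₃').1 ?_, (hr₁₂ _ hX₁).1 ?_, (hp₃ _ hZ₂₃').1 ?_,
    (hr₁₃ _ hX₂).1 ?_, isColimitOfCauchyTriangles_of_isLocal r₁₂ r₁₃ hr₁₂' hr₁₃' hZ₁₂' hZ₁₃' hZ₂₃'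
      O.mem hr₂₃ hm₁.symm hm₃.symm ?_⟩
  · dsimp only
    rw [← reassoc_of% τ₁₂.comm₂, hm₁, ← Functor.map_comp_assoc, O.comm₁, Functor.map_comp_assoc,
      τ₁₃.comm₂, reassoc_of% τ₂₃.comm₁]
  · dsimp only
    rw [reassoc_of% hm₁, ← τ₁₃.comm₃, ← Functor.map_comp_assoc, O.comm₂, τ₁₂.comm₃]
  · dsimp only
    rw [← reassoc_of% τ₁₃.comm₂, hm₃, ← Functor.map_comp_assoc, O.comm₃, τ₂₃.comm₂]
  · dsimp only
    rw [← reassoc_of% τ₁₃.comm₃, ← Presentation.shift_comm (τ₁₂.comm₁ N),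
      ← Functor.map_comp_assoc, O.comm₄, Functor.map_comp_assoc, τ₂₃.comm₃, reassoc_of% hm₃]
  · rw [Functor.map_comp_assoc, Presentation.shift_comm (τ₁₂.comm₂ N), reassoc_of% τ₂₃.comm₃]

end Metric

end MetricCompletion

/-! ### The triangulated structure on the completion -/

namespace MetricCompletion

variable {C : Type u} [Category.{v} C] [Preadditive C] [HasZeroObject C] [HasShift C ℤ]
  [∀ n : ℤ, (shiftFunctor C n).Additive] [Pretriangulated C]

namespace Metric

variable {μ : Metric C}

/-- The morphism `Z ⟶ X⟦1⟧` of `𝔖(C)` given by a morphism of `Mod C`. The shift of the full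
subcategory agrees with the shift of `Mod C` only up to isomorphism. -/
noncomputable def homShiftMk {X Z : μ.completion.FullSubcategory}
    (h : Z.obj ⟶ X.obj⟦(1 : ℤ)⟧) : Z ⟶ X⟦(1 : ℤ)⟧ :=
  ObjectProperty.homMk (h ≫ (μ.completion.ι.commShiftIso (1 : ℤ)).inv.app X)

lemma homShiftMk_hom {X Z : μ.completion.FullSubcategory} (h : Z.obj ⟶ X.obj⟦(1 : ℤ)⟧) :
    μ.completion.ι.map (homShiftMk h) ≫ (μ.completion.ι.commShiftIso (1 : ℤ)).hom.app X = h := by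
  change (h ≫ (μ.completion.ι.commShiftIso (1 : ℤ)).inv.app X) ≫ _ = h
  rw [Category.assoc, Iso.inv_hom_id_app]
  exact Category.comp_id h

lemma mk_mem_distinguishedTriangles {X Y Z : μ.completion.FullSubcategory} {f : X ⟶ Y}
    {g : Y ⟶ Z} {h : Z ⟶ X⟦(1 : ℤ)⟧} {h' : Z.obj ⟶ X.obj⟦(1 : ℤ)⟧}
    (hh : μ.completion.ι.map h ≫ (μ.completion.ι.commShiftIso (1 : ℤ)).hom.app X = h')
    (H : μ.IsColimitOfCauchyTriangles (Triangle.mk f.hom g.hom h')) :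
    Triangle.mk f g h ∈ μ.distinguishedTriangles := by
  subst hh
  exact H

lemma mk_homShiftMk_mem {X Y Z : μ.completion.FullSubcategory} (f : X ⟶ Y) (g : Y.obj ⟶ Z.obj)
    (h : Z.obj ⟶ X.obj⟦(1 : ℤ)⟧) (H : μ.IsColimitOfCauchyTriangles (Triangle.mk f.hom g h)) :
    Triangle.mk f (ObjectProperty.homMk g) (homShiftMk h) ∈ μ.distinguishedTriangles :=
  mk_mem_distinguishedTriangles (homShiftMk_hom h) H

lemma hom_ext_shift {X Z : μ.completion.FullSubcategory} {h h' : Z ⟶ X⟦(1 : ℤ)⟧}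
    (H : μ.completion.ι.map h ≫ (μ.completion.ι.commShiftIso (1 : ℤ)).hom.app X =
      μ.completion.ι.map h' ≫ (μ.completion.ι.commShiftIso (1 : ℤ)).hom.app X) : h = h' :=
  μ.completion.ι.map_injective ((cancel_mono _).1 H)

lemma map_comp_shift {X Y Z : μ.completion.FullSubcategory} (h : Z ⟶ X⟦(1 : ℤ)⟧) (f : X ⟶ Y) :
    μ.completion.ι.map (h ≫ f⟦(1 : ℤ)⟧') ≫ (μ.completion.ι.commShiftIso (1 : ℤ)).hom.app Y =
      (μ.completion.ι.map h ≫ (μ.completion.ι.commShiftIso (1 : ℤ)).hom.app X) ≫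
        f.hom⟦(1 : ℤ)⟧' := by
  have := (μ.completion.ι.commShiftIso (1 : ℤ)).hom.naturality f
  dsimp at this ⊢
  rw [Category.assoc, Category.assoc, this]

variable [IsTriangulated C]

lemma contractible_mem_distinguishedTriangles (X : μ.completion.FullSubcategory) :
    contractibleTriangle X ∈ μ.distinguishedTriangles := by
  have hz : IsZero (0 : μ.completion.FullSubcategory).obj :=
    μ.completion.ι.map_isZero (isZero_zero _)
  have hX : μ.completion X.obj := X.property
  refine mk_mem_distinguishedTriangles (f := 𝟙 X) (g := 0) (h := 0) (h' := 0) ?_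
    (isColimitOfCauchyTriangles_id hX.1 hz)
  rw [Functor.map_zero, zero_comp]

lemma exists_mem_distinguishedTriangles {X Y : μ.completion.FullSubcategory} (f : X ⟶ Y) :
    ∃ (Z : μ.completion.FullSubcategory) (g : Y ⟶ Z) (h : Z ⟶ X⟦(1 : ℤ)⟧),
      Triangle.mk f g h ∈ μ.distinguishedTriangles := by
  obtain ⟨D, hD, g, h, H⟩ := exists_isColimitOfCauchyTriangles X.property Y.property f.hom
  exact ⟨⟨D, hD⟩, _, _, mk_homShiftMk_mem (Z := ⟨D, hD⟩) f g h H⟩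

variable (μ)

/-- The pretriangulated structure on `𝔖(C)`. -/
noncomputable abbrev pretriangulatedCompletion : Pretriangulated μ.completion.FullSubcategory where
  distinguishedTriangles := μ.distinguishedTriangles
  isomorphic_distinguished _ hT _ e :=
    IsColimitOfCauchyTriangles.of_iso hT (μ.completion.ι.mapTriangle.mapIso e.symm)
  contractible_distinguished X := contractible_mem_distinguishedTriangles X
  distinguished_cocone_triangle := exists_mem_distinguishedTriangles
  rotate_distinguished_triangle T := by
    refine ⟨fun hT => (IsColimitOfCauchyTriangles.rotate hT).of_iso
      (μ.completion.ι.mapTriangleRotateIso.app T), fun hT => ?_⟩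
    have hT' : μ.IsColimitOfCauchyTriangles (μ.completion.ι.mapTriangle.obj T).rotate :=
      hT.of_iso (μ.completion.ι.mapTriangleRotateIso.app T).symm
    exact hT'.invRotate.of_iso (rotCompInvRot.app (μ.completion.ι.mapTriangle.obj T)).symm
  complete_distinguished_triangle_morphism T₁ T₂ hT₁ hT₂ a b hab := by
    obtain ⟨c, hc₁, hc₂⟩ := IsColimitOfCauchyTriangles.complete_morphism hT₁ hT₂
      T₂.obj₁.property T₂.obj₃.property a.hom b.hom
      (congrArg (fun x => μ.completion.ι.map x) hab)
    refine ⟨ObjectProperty.homMk c, ObjectProperty.hom_ext _ hc₁, hom_ext_shift ?_⟩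
    rw [map_comp_shift, Functor.map_comp, Category.assoc]
    exact hc₂

lemma isTriangulated_completion :
    let _ := μ.pretriangulatedCompletion
    IsTriangulated μ.completion.FullSubcategory := by
  let _ := μ.pretriangulatedCompletion
  refine IsTriangulated.mk' fun X₁ X₂ X₃ u₁₂ u₂₃ => ?_
  obtain ⟨Z₁₂, Z₂₃, Z₁₃, hZ₁₂, hZ₂₃, hZ₁₃, v₁₂, w₁₂, v₂₃, w₂₃, v₁₃, w₁₃, m₁, m₃, h₁₂, h₂₃, h₁₃,
    c₁, c₂, c₃, c₄, hm⟩ := exists_octahedron X₁.property X₂.property X₃.property u₁₂.hom u₂₃.hom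
  refine ⟨X₁, X₂, X₃, ⟨Z₁₂, hZ₁₂⟩, ⟨Z₂₃, hZ₂₃⟩, ⟨Z₁₃, hZ₁₃⟩, u₁₂, u₂₃, Iso.refl _, Iso.refl _,
    Iso.refl _, (Category.comp_id _).trans (Category.id_comp _).symm,
    (Category.comp_id _).trans (Category.id_comp _).symm,
    _, _, mk_homShiftMk_mem (Z := ⟨Z₁₂, hZ₁₂⟩) u₁₂ v₁₂ w₁₂ h₁₂,
    _, _, mk_homShiftMk_mem (Z := ⟨Z₂₃, hZ₂₃⟩) u₂₃ v₂₃ w₂₃ h₂₃,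
    _, _, mk_homShiftMk_mem (Z := ⟨Z₁₃, hZ₁₃⟩) (u₁₂ ≫ u₂₃) v₁₃ w₁₃ h₁₃,
    ⟨⟨ObjectProperty.homMk m₁, ObjectProperty.homMk m₃, ObjectProperty.hom_ext _ c₁, ?_,
      ObjectProperty.hom_ext _ c₃, ?_, mk_mem_distinguishedTriangles ?_ hm⟩⟩⟩
  · apply hom_ext_shift
    rw [Functor.map_comp, Category.assoc, homShiftMk_hom, homShiftMk_hom]
    exact c₂
  · apply hom_ext_shift
    rw [map_comp_shift, homShiftMk_hom, Functor.map_comp, Category.assoc, homShiftMk_hom]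
    exact c₄
  · rw [map_comp_shift, homShiftMk_hom]
    rfl

end Metric

end MetricCompletion

theorem theorem2 {C : Type u} [Category.{v} C] [Preadditive C] [HasZeroObject C] [HasShift C ℤ]
    [∀ n : ℤ, (shiftFunctor C n).Additive] [Pretriangulated C] [IsTriangulated C]
    [EssentiallySmall.{v} C] (μ : MetricCompletion.Metric C) :
    ∃ _ : Pretriangulated μ.completion.FullSubcategory,
      distTriang μ.completion.FullSubcategory = μ.distinguishedTriangles ∧
        IsTriangulated μ.completion.FullSubcategory :=
  ⟨μ.pretriangulatedCompletion, rfl, μ.isTriangulated_completion⟩
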